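/- Let $k\in 2\mathbb Z$, let $n$ be a non-zero integer, let $m\ge 0$ be an integer, and let \[ \Delta_k = y^2\left(\frac{\partial^2}{\partial x^2}+\frac{\partial^2}{\partial y^2}\right) - iky\left(\frac{\partial}{\partial x}+i\frac{\partial}{\partial y}\right),\qquad z=x+iy, \] be the weight $k$ hyperbolic Laplacian on the upper half-plane $\mathbb H$. For $y>0$ let $W_{\kappa,\mu}(y)$ be the standard $W$-Whittaker function, and let $\mathcal M^+_{\kappa,\mu}(y) = W_{-\kappa,\mu}(ye^{\pi i})$, where $W_{-\kappa,\mu}$ is continued analytically from the positive to the negative real axis through the upper half-plane. For $s_0\in\mathbb C$ and $j\ge 0$ put $r_j=j$ if $s_0\ne\frac{1-k}{2}$ and $r_j=2j$ if $s_0=\frac{1-k}{2}$, and define \[ u^{[j],-}_{k,n}(y;s_0) = y^{-k/2}\,\frac{\partial^{r_j}}{\partial s^{r_j}} W_{\operatorname{sgn}(n)\frac k2,\; s+\frac{k-1}{2}}(4\pi|n|y)\Big|_{s=s_0},\qquad u^{[j],+}_{k,n}(y;s_0) = y^{-k/2}\,\frac{\partial^{r_j}}{\partial s^{r_j}} \mathcal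 M^+_{\operatorname{sgn}(n)\frac k2,\; s+\frac{k-1}{2}}(4\pi|n|y)\Big|_{s=s_0}. \] Let $\lambda\in\mathbb C$ and suppose that $f(z)=h(y)e^{2\pi i n x}$ is a $2m$ times continuously differentiable function on $\mathbb H$ with \[ (\Delta_k-\lambda)^m f(z)=0\quad\text{for all } z=x+iy\in\mathbb H . \] Write $\lambda=s_0(s_0+k-1)$ with $s_0\in\mathbb C$ (any choice of such an $s_0$). Then there are constants $a_j^-,a_j^+\in\mathbb C$, $0\le j<m$, such that \[ h(y)=\sum_{j=0}^{m-1}\left(a_j^-\,u^{[j],-}_{k,n}(y;s_0)+a_j^+\,u^{[j],+}_{k,n}(y;s_0)\right)\qquad\text{for all } y>0 . \] -/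

import Mathlib

open scoped UpperHalfPlane Topology

noncomputable section

/-! ### The weight `k` hyperbolic Laplacian on the upper half-plane -/

/-- The partial derivative `∂f/∂x` of a function on the upper half-plane, `z = x + iy`. -/
def partialX (f : ℍ → ℂ) : ℍ → ℂ :=
  fun z => lineDeriv ℝ (f ∘ UpperHalfPlane.ofComplex) (z : ℂ) 1

/-- The partial derivative `∂f/∂y` of a function on the upper half-plane, `z = x + iy`. -/
def partialY (f : ℍ → ℂ) : ℍ → ℂ :=
  fun z => lineDeriv ℝ (f ∘ UpperHalfPlane.ofComplex) (z : ℂ) Complex.I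

/-- The weight `k` hyperbolic Laplacian
`Δ_k = y² (∂²/∂x² + ∂²/∂y²) - i k y (∂/∂x + i ∂/∂y)`. -/
def hypLaplacian (k : ℤ) (f : ℍ → ℂ) : ℍ → ℂ :=
  fun z => (z.im : ℂ) ^ 2 * (partialX (partialX f) z + partialY (partialY f) z)
    - Complex.I * k * z.im * (partialX f z + Complex.I * partialY f z)

/-- The operator `Δ_k - lam`. -/
def shiftedLaplacian (k : ℤ) (lam : ℂ) (f : ℍ → ℂ) : ℍ → ℂ :=
  fun z => hypLaplacian k f z - lam * f z

/-- `f` is a classical (that is, `C^{2m}`) solution of `(Δ_k - lam)^m f = 0` on the upper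
half-plane. -/
def IsShiftedPolyharmonic (k : ℤ) (lam : ℂ) (m : ℕ) (f : ℍ → ℂ) : Prop :=
  ContDiffOn ℝ ((2 * m : ℕ) : WithTop ℕ∞) (f ∘ UpperHalfPlane.ofComplex) {z : ℂ | 0 < z.im} ∧
    ∀ z : ℍ, (shiftedLaplacian k lam)^[m] f z = 0

/-! ### Whittaker functions

The Whittaker functions are multivalued in `z ≠ 0`, with branch point `0`. They are defined here
on the Riemann surface of the logarithm: the complex number `w` stands for the point with
logarithm `w`, lying over `z = exp w`. The principal branch at `z = y > 0` is the value at
`w = log y`, and the point `y e^{πi}`, reached from `y` through the upper half-plane, is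
`w = log y + πi`. -/

/-- Kummer's function `₁F₁(a; b; z) = ∑ (a)_n / (b)_n * z^n / n!`, for `b ∉ {0, -1, -2, …}`:
`Γ(b)` times the regularized function `∑ (a)_n / Γ(b+n) * z^n / n!`. -/
def kummerM (a b z : ℂ) : ℂ :=
  Complex.Gamma b * Complex.regularizedHGFun {a} {b} z

/-- The Whittaker function `M_{κ,μ}(z) = e^{-z/2} z^{1/2+μ} ₁F₁(1/2+μ-κ; 1+2μ; z)` at `z = exp w`,
for `1 + 2μ ∉ {0, -1, -2, …}`. -/
def whittakerM (κ μ w : ℂ) : ℂ :=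
  Complex.exp (-Complex.exp w / 2) * Complex.exp ((1 / 2 + μ) * w) *
    kummerM (1 / 2 + μ - κ) (1 + 2 * μ) (Complex.exp w)

/-- For `2μ ∉ ℤ`, the combination
`Γ(-2μ)/Γ(1/2-μ-κ) M_{κ,μ}(z) + Γ(2μ)/Γ(1/2+μ-κ) M_{κ,-μ}(z)` at `z = exp w`.
(`1/Γ` is `0` at the poles of `Γ`, which is also what `(Complex.Gamma _)⁻¹` gives.) -/
def whittakerWGeneric (κ μ w : ℂ) : ℂ :=
  Complex.Gamma (-2 * μ) * (Complex.Gamma (1 / 2 - μ - κ))⁻¹ * whittakerM κ μ w +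
    Complex.Gamma (2 * μ) * (Complex.Gamma (1 / 2 + μ - κ))⁻¹ * whittakerM κ (-μ) w

open Classical in
/-- The Whittaker function `W_{κ,μ}(z)` at `z = exp w`, for all `κ, μ ∈ ℂ`: it is given by
`whittakerWGeneric` when `2μ ∉ ℤ`, and by the limit in `μ` of those values when `2μ ∈ ℤ`. -/
def whittakerW (κ μ w : ℂ) : ℂ :=
  if ∃ p : ℤ, 2 * μ = p then Filter.limUnder (𝓝[≠] μ) (fun ν => whittakerWGeneric κ ν w)
  else whittakerWGeneric κ μ w

/-- `W_{κ,μ}(y)` for real `y > 0`. -/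
def whittakerWReal (κ μ : ℂ) (y : ℝ) : ℂ :=
  whittakerW κ μ (Real.log y)

/-- `𝓜⁺_{κ,μ}(y) = W_{-κ,μ}(y e^{πi})` for real `y > 0`: the continuation of `W_{-κ,μ}` from the
positive to the negative real axis through the upper half-plane. -/
def whittakerMPlus (κ μ : ℂ) (y : ℝ) : ℂ :=
  whittakerW (-κ) μ (Real.log y + Real.pi * Complex.I)

/-! ### The functions `u^{[j],±}_{k,n}(y; s₀)` -/

open Classical in
/-- The order of the `s`-derivative in `u^{[j],±}_{k,n}(y; s₀)`: it is `j` if `s₀ ≠ (1-k)/2` and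
`2j` if `s₀ = (1-k)/2`. -/
def derivOrder (k : ℤ) (s₀ : ℂ) (j : ℕ) : ℕ :=
  if s₀ = (1 - (k : ℂ)) / 2 then 2 * j else j

/-- `u^{[j],-}_{k,n}(y; s₀)`: the factor `y^{-k/2}` times an `s`-derivative at `s = s₀` of
`W_{sgn(n) k/2, s + (k-1)/2}(4π|n|y)`. -/
def uMinus (k n : ℤ) (j : ℕ) (s₀ : ℂ) (y : ℝ) : ℂ :=
  (y : ℂ) ^ (-(k : ℂ) / 2) *
    iteratedDeriv (derivOrder k s₀ j)
      (fun s : ℂ => whittakerWReal ((n.sign : ℂ) * (k : ℂ) / 2) (s + ((k : ℂ) - 1) / 2)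
        (4 * Real.pi * |(n : ℝ)| * y)) s₀

/-- `u^{[j],+}_{k,n}(y; s₀)`: the factor `y^{-k/2}` times an `s`-derivative at `s = s₀` of
`𝓜⁺_{sgn(n) k/2, s + (k-1)/2}(4π|n|y)`. -/
def uPlus (k n : ℤ) (j : ℕ) (s₀ : ℂ) (y : ℝ) : ℂ :=
  (y : ℂ) ^ (-(k : ℂ) / 2) *
    iteratedDeriv (derivOrder k s₀ j)
      (fun s : ℂ => whittakerMPlus ((n.sign : ℂ) * (k : ℂ) / 2) (s + ((k : ℂ) - 1) / 2)
        (4 * Real.pi * |(n : ℝ)| * y)) s₀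

end

/-! On a Fourier mode `a(y) e^{2πinx}` the operator `Δ_k - λ` acts through a second-order operator
in `y`. Setting `4π|n| y = e^t` and multiplying by `y^{k/2}` turns that operator into `A g = g'' -
g' - q g` with `q = e^{2t}/4 - κ e^t + μ² - 1/4`, `κ = sgn(n) k/2` and `μ = s₀ + (k-1)/2`. This is
Whittaker's operator in the logarithmic variable; it annihilates `W_{κ,μ}(e^t)` and
`W_{-κ,μ}(e^{t+πi})`.

Since `q` depends on `μ` only through `μ²`, differentiating either solution `j` times in `μ` gives
`A W^{(j)} = 2jμ W^{(j-1)} + j(j-1) W^{(j-2)}`. For `μ ≠ 0` this lowers the order by one with a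
nonzero leading coefficient. For `μ = 0`, that is `s₀ = (1-k)/2`, the even derivatives form a chain
of their own, `A W^{(2j)} = 2j(2j-1) W^{(2j-2)}`. In both cases every element of the span of the
first `m` members of the two chains has an `A`-preimage in the span of the first `m+1`, and the
kernel of `A` is spanned by the two initial members; induction on `m` then describes the kernel of
`A^m` (`mem_chainSpan_of_iterate_abelOp_eq_zero`).

Two analytic facts feed this argument, both needed for every `μ`, including `2μ ∈ ℤ`. First, `W` is
entire in `μ` and its `μ`-derivatives may be differentiated in the variable: the singularities of
`π/sin(2πμ)` times an entire numerator are removable (`differentiable_whittakerW`), and the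
`μ`-derivatives are Cauchy integrals over circles that avoid these singularities
(`exists_hasDerivAt_whittakerJet`). Second, the two solutions are independent: their Wronskian is
`e^{-πiκ} e^w` (`whittakerW_wronskian`). -/

open Filter Complex

/-! ### The regularized Kummer function -/

/-- The coefficients `(a)_n / (Γ(b+n) n!)` of the regularized Kummer function. -/
noncomputable def kummerCoeff (a b : ℂ) (n : ℕ) : ℂ :=
  (ascPochhammer ℂ n).eval a * (Gamma (b + n))⁻¹ / n.factorial

/-- The regularized Kummer function `∑ (a)_n / Γ(b+n) * z^n / n!`. -/
noncomputable def kummerReg (a b z : ℂ) : ℂ := ∑' n : ℕ, kummerCoeff a b n * z ^ n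

theorem regularizedHGFun_eq_kummerReg (a b z : ℂ) :
    Complex.regularizedHGFun {a} {b} z = kummerReg a b z := by
  unfold Complex.regularizedHGFun Complex.regularizedHGFunSeries kummerReg
  rw [← FormalMultilinearSeries.ofScalarsSum, FormalMultilinearSeries.ofScalarsSum_eq_tsum]
  refine tsum_congr fun n => ?_
  simp only [regularizedHGFunCoeff, kummerCoeff, Multiset.map_singleton, Multiset.prod_singleton,
    smul_eq_mul]
  rw [div_eq_mul_inv, div_eq_mul_inv, mul_inv]
  ring

theorem kummerCoeff_succ (a b : ℂ) (n : ℕ) :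
    (n + 1) * (b + n) * kummerCoeff a b (n + 1) = (a + n) * kummerCoeff a b n := by
  have h1 := Complex.one_div_Gamma_eq_self_mul_one_div_Gamma_add_one (b + n)
  have h2 : b + ((n + 1 : ℕ) : ℂ) = b + n + 1 := by push_cast; ring
  have h3 : (n.factorial : ℂ) ≠ 0 := by exact_mod_cast n.factorial_ne_zero
  have h4 : (n : ℂ) + 1 ≠ 0 := by exact_mod_cast n.succ_ne_zero
  simp only [kummerCoeff, h1, h2, ascPochhammer_succ_right, Nat.factorial_succ]
  simp only [Polynomial.eval_mul, Polynomial.eval_add, Polynomial.eval_X, Polynomial.eval_natCast]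
  push_cast
  field_simp

theorem kummerCoeff_succ_shift (a b : ℂ) (n : ℕ) :
    (n + 1) * kummerCoeff a b (n + 1) = a * kummerCoeff (a + 1) (b + 1) n := by
  have h2 : b + ((n + 1 : ℕ) : ℂ) = b + 1 + n := by push_cast; ring
  have h3 : (n.factorial : ℂ) ≠ 0 := by exact_mod_cast n.factorial_ne_zero
  have h4 : (n : ℂ) + 1 ≠ 0 := by exact_mod_cast n.succ_ne_zero
  simp only [kummerCoeff, h2, ascPochhammer_succ_left, Nat.factorial_succ]
  simp only [Polynomial.eval_mul, Polynomial.eval_X, Polynomial.eval_comp, Polynomial.eval_add,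
    Polynomial.eval_one]
  push_cast
  field_simp

theorem differentiable_kummerCoeff (n : ℕ) {α β : ℂ → ℂ} (hα : Differentiable ℂ α)
    (hβ : Differentiable ℂ β) : Differentiable ℂ fun s => kummerCoeff (α s) (β s) n := by
  unfold kummerCoeff
  refine Differentiable.div_const (Differentiable.mul ?_ ?_) _
  · exact (Polynomial.differentiable _).comp hα
  · exact differentiable_one_div_Gamma.comp (hβ.add_const _)

theorem continuous_kummerCoeff (n : ℕ) :
    Continuous fun p : ℂ × ℂ => kummerCoeff p.1 p.2 n := by
  unfold kummerCoeff
  refine Continuous.div_const (Continuous.mul ?_ ?_) _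
  · exact (Polynomial.continuous _).comp continuous_fst
  · exact differentiable_one_div_Gamma.continuous.comp (continuous_snd.add continuous_const)

/-- For `n > 3ρ` one has `‖a + n‖ ≤ n + ρ ≤ 2(n - ρ) ≤ 2‖b + n‖`, so the recurrence gives factorial
decay uniformly in bounded parameters. -/
theorem norm_kummerCoeff_succ_le {ρ : ℝ} {a b : ℂ} (ha : ‖a‖ ≤ ρ) (hb : ‖b‖ ≤ ρ) {n : ℕ}
    (hn : 3 * ρ < n) : ‖kummerCoeff a b (n + 1)‖ ≤ 2 / (n + 1) * ‖kummerCoeff a b n‖ := by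
  have hρ : 0 ≤ ρ := (norm_nonneg a).trans ha
  have h := congrArg norm (kummerCoeff_succ a b n)
  have h1 : ‖(n : ℂ) + 1‖ = n + 1 := by
    rw [← Nat.cast_succ, Complex.norm_natCast]; push_cast; ring
  simp only [norm_mul, h1] at h
  have h2 : (n : ℝ) - ρ ≤ ‖b + n‖ := by
    have := norm_sub_norm_le (n : ℂ) (-b)
    rw [norm_neg, Complex.norm_natCast, sub_neg_eq_add, add_comm (n : ℂ)] at this
    linarith
  have h3 : ‖a + n‖ ≤ ρ + n := (norm_add_le _ _).trans (by rw [Complex.norm_natCast]; linarith)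
  have h5 : 0 < ‖b + n‖ := by linarith
  have h6 : (0 : ℝ) < n + 1 := by positivity
  rw [div_mul_eq_mul_div, le_div_iff₀ h6]
  refine le_of_mul_le_mul_right ?_ h5
  calc _ = ((n : ℝ) + 1) * ‖b + n‖ * ‖kummerCoeff a b (n + 1)‖ := by ring
    _ = ‖a + n‖ * ‖kummerCoeff a b n‖ := h
    _ ≤ (2 * ‖b + n‖) * ‖kummerCoeff a b n‖ := by gcongr; linarith
    _ = _ := by ring

theorem exists_bound_kummerCoeff (ρ : ℝ) :
    ∃ (m : ℕ) (C : ℝ), 0 ≤ C ∧ ∀ a b : ℂ, ‖a‖ ≤ ρ → ‖b‖ ≤ ρ → ∀ j : ℕ,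
      ‖kummerCoeff a b (j + m)‖ ≤ C * (2 ^ j / j.factorial) := by
  obtain ⟨m, hm⟩ := exists_nat_gt (3 * ρ)
  have hK : IsCompact (Metric.closedBall (0 : ℂ) ρ ×ˢ Metric.closedBall (0 : ℂ) ρ) :=
    (isCompact_closedBall _ _).prod (isCompact_closedBall _ _)
  obtain ⟨C, hC⟩ := hK.exists_bound_of_continuousOn (continuous_kummerCoeff m).continuousOn
  refine ⟨m, max C 0, le_max_right _ _, fun a b ha hb j => ?_⟩
  induction j with
  | zero =>
    have := hC (a, b) ⟨by simpa using ha, by simpa using hb⟩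
    simpa using Or.inl this
  | succ j ih =>
    have hρ : 0 ≤ ρ := (norm_nonneg a).trans ha
    have h0 : (0 : ℝ) ≤ m := m.cast_nonneg
    have hj : (0 : ℝ) ≤ j := j.cast_nonneg
    have h1 := norm_kummerCoeff_succ_le ha hb (n := j + m) (by push_cast; linarith)
    rw [show j + 1 + m = j + m + 1 by ring]
    refine h1.trans ?_
    calc _ ≤ 2 / ((j : ℝ) + 1) * (max C 0 * (2 ^ j / j.factorial)) := by
            push_cast
            gcongr
            linarith
      _ = _ := by
            rw [Nat.factorial_succ]; push_cast; field_simp; ring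

theorem exists_summable_bound_kummerReg (ρ : ℝ) :
    ∃ u : ℕ → ℝ, Summable u ∧ ∀ᶠ n in atTop, ∀ p : ℂ × ℂ × ℂ, ‖p‖ ≤ ρ →
      ‖kummerCoeff p.1 p.2.1 n * p.2.2 ^ n‖ ≤ u n := by
  obtain ⟨m, C, hC0, hC⟩ := exists_bound_kummerCoeff ρ
  refine ⟨fun n => C * |ρ| ^ m * ((2 * |ρ|) ^ (n - m) / (n - m).factorial), ?_, ?_⟩
  · rw [← summable_nat_add_iff m]
    simpa using (Real.summable_pow_div_factorial (2 * |ρ|)).mul_left _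
  · filter_upwards [eventually_ge_atTop m] with n hn p hp
    obtain ⟨j, rfl⟩ := Nat.exists_eq_add_of_le' hn
    have h1 := (norm_fst_le p).trans hp
    have h2 := (norm_snd_le p).trans hp
    have h3 := (norm_fst_le p.2).trans h2
    have h4 := ((norm_snd_le p.2).trans h2).trans (le_abs_self ρ)
    rw [norm_mul, norm_pow, Nat.add_sub_cancel]
    calc _ ≤ (C * (2 ^ j / j.factorial)) * |ρ| ^ (j + m) := by
            gcongr
            exact hC _ _ h1 h3 j
      _ = _ := by rw [mul_pow, pow_add]; ring

theorem summable_kummerReg (a b z : ℂ) : Summable fun n : ℕ => kummerCoeff a b n * z ^ n := by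
  obtain ⟨u, hu, h⟩ := exists_summable_bound_kummerReg ‖(a, b, z)‖
  exact hu.of_norm_bounded_eventually_nat (h.mono fun n hn => hn (a, b, z) le_rfl)

theorem tendstoLocallyUniformly_kummerReg :
    TendstoLocallyUniformly
      (fun (N : ℕ) (p : ℂ × ℂ × ℂ) => ∑ n ∈ Finset.range N, kummerCoeff p.1 p.2.1 n * p.2.2 ^ n)
      (fun p => kummerReg p.1 p.2.1 p.2.2) atTop := by
  rw [tendstoLocallyUniformly_iff_forall_isCompact]
  intro K hK
  obtain ⟨ρ, hρ⟩ := hK.isBounded.exists_norm_le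
  obtain ⟨u, hu, h⟩ := exists_summable_bound_kummerReg ρ
  exact tendstoUniformlyOn_tsum_nat_eventually hu (h.mono fun n hn p hp => hn p (hρ p hp))

theorem continuous_kummerReg : Continuous fun p : ℂ × ℂ × ℂ => kummerReg p.1 p.2.1 p.2.2 := by
  refine tendstoLocallyUniformly_kummerReg.continuous (Frequently.of_forall fun N => ?_)
  refine continuous_finsetSum _ fun n _ => Continuous.mul ?_ (by fun_prop)
  exact (continuous_kummerCoeff n).comp (continuous_fst.prodMk (continuous_fst.comp continuous_snd))

theorem differentiable_kummerReg {α β γ : ℂ → ℂ} (hα : Differentiable ℂ α)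
    (hβ : Differentiable ℂ β) (hγ : Differentiable ℂ γ) :
    Differentiable ℂ fun s => kummerReg (α s) (β s) (γ s) := by
  have h := tendstoLocallyUniformly_kummerReg.comp (fun s => (α s, β s, γ s))
    (by have := hα.continuous; have := hβ.continuous; have := hγ.continuous; fun_prop)
  rw [← differentiableOn_univ]
  refine (tendstoLocallyUniformlyOn_univ.2 h).differentiableOn (.of_forall fun N => ?_) isOpen_univ
  refine Differentiable.differentiableOn ?_
  simp only [Function.comp_def]
  refine Differentiable.fun_sum fun n _ => ?_
  exact (differentiable_kummerCoeff n hα hβ).mul (hγ.pow n)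

theorem hasSum_deriv_kummerReg (a b z : ℂ) :
    HasSum (fun n : ℕ => (n + 1) * kummerCoeff a b (n + 1) * z ^ n)
      (a * kummerReg (a + 1) (b + 1) z) := by
  have h := (summable_kummerReg (a + 1) (b + 1) z).hasSum.mul_left a
  refine h.congr_fun fun n => ?_
  rw [kummerCoeff_succ_shift, mul_assoc]

theorem hasDerivAt_kummerReg (a b z : ℂ) :
    HasDerivAt (kummerReg a b) (a * kummerReg (a + 1) (b + 1) z) z := by
  have hd : Differentiable ℂ (kummerReg a b) :=
    differentiable_kummerReg (differentiable_const a) (differentiable_const b) differentiable_id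
  have h := tendstoLocallyUniformly_kummerReg.comp (fun s : ℂ => (a, b, s)) (by fun_prop)
  have h' := (tendstoLocallyUniformlyOn_univ.2 h).deriv (.of_forall fun N => ?_) isOpen_univ
  -- The index is shifted by one because differentiation kills the constant term: the first `N + 1`
  -- terms produce `N` terms.
  · have h1 := (h'.tendsto_at (Set.mem_univ z)).comp (tendsto_add_atTop_nat 1)
    have h2 := (hasSum_deriv_kummerReg a b z).tendsto_sum_nat
    have h3 := tendsto_nhds_unique (h2.congr fun N => ?_) h1
    · rw [h3]
      exact (hd z).hasDerivAt
    · simp only [Function.comp_def]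
      rw [deriv_fun_sum (fun n _ => by fun_prop), Finset.sum_range_succ']
      simp
      refine Finset.sum_congr rfl fun n _ => by ring
  · refine Differentiable.differentiableOn ?_
    simp only [Function.comp_def]
    fun_prop

theorem hasSum_shift_mul {c : ℕ → ℂ} {z s : ℂ} (h : HasSum (fun n => c (n + 1) * z ^ n) s)
    (h0 : c 0 = 0) : HasSum (fun n => c n * z ^ n) (z * s) := by
  rw [← hasSum_nat_add_iff' 1]
  simp only [Finset.sum_range_one, h0, zero_mul, sub_zero]
  refine (h.mul_left z).congr_fun fun n => ?_
  ring

/-- Kummer's differential equation. -/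
theorem kummerReg_ode (a b z : ℂ) :
    z * (a * ((a + 1) * kummerReg (a + 1 + 1) (b + 1 + 1) z)) +
      (b - z) * (a * kummerReg (a + 1) (b + 1) z) - a * kummerReg a b z = 0 := by
  have h0 := (summable_kummerReg a b z).hasSum
  have h1 := hasSum_deriv_kummerReg a b z
  have h2 := (hasSum_deriv_kummerReg (a + 1) (b + 1) z).mul_left a
  have h3 : HasSum (fun n : ℕ => (n * kummerCoeff a b n) * z ^ n)
      (z * (a * kummerReg (a + 1) (b + 1) z)) :=
    hasSum_shift_mul (c := fun n => n * kummerCoeff a b n) (by simpa using h1) (by simp)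
  have h4 : HasSum (fun n : ℕ => (n * ((n + 1) * kummerCoeff a b (n + 1))) * z ^ n)
      (z * (a * ((a + 1) * kummerReg (a + 1 + 1) (b + 1 + 1) z))) := by
    refine hasSum_shift_mul (c := fun n => n * ((n + 1) * kummerCoeff a b (n + 1)))
      (h2.congr_fun fun n => ?_) (by simp)
    have := kummerCoeff_succ_shift a b (n + 1)
    push_cast at this ⊢
    rw [this]
    ring
  have h5 := ((h4.add (h1.mul_left b)).sub h3).sub (h0.mul_left a)
  -- Coefficientwise, Kummer's equation is the two-term recurrence `kummerCoeff_succ`.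
  have h6 : ∀ n : ℕ, n * ((n + 1) * kummerCoeff a b (n + 1)) * z ^ n +
      b * ((n + 1) * kummerCoeff a b (n + 1) * z ^ n) - n * kummerCoeff a b n * z ^ n -
      a * (kummerCoeff a b n * z ^ n) = 0 := fun n => by
    linear_combination z ^ n * kummerCoeff_succ a b n
  simp only [h6] at h5
  have h7 := h5.unique hasSum_zero
  change _ - a * kummerReg a b z = 0 at h7
  linear_combination h7

theorem kummerReg_zero (a b : ℂ) : kummerReg a b 0 = (Gamma b)⁻¹ := by
  unfold kummerReg
  rw [tsum_eq_single 0 fun n hn => by simp [hn]]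
  simp [kummerCoeff]

theorem inv_Gamma_eq_ascPochhammer_mul (a : ℂ) (p : ℕ) :
    (Gamma a)⁻¹ = (ascPochhammer ℂ p).eval a * (Gamma (a + p))⁻¹ := by
  induction p with
  | zero => simp
  | succ p ih =>
    have h1 := Complex.one_div_Gamma_eq_self_mul_one_div_Gamma_add_one (a + p)
    rw [ih, h1, ascPochhammer_succ_right]
    simp only [Polynomial.eval_mul, Polynomial.eval_add, Polynomial.eval_X,
      Polynomial.eval_natCast]
    push_cast
    rw [add_assoc a]
    ring

/-- At `b = 1 - p` the factor `1/Γ(b+n)` vanishes for `n < p`, so the series starts at `z^p`;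
reindexing the tail gives a Kummer series again. -/
theorem kummerReg_one_sub_nat (a z : ℂ) (p : ℕ) :
    kummerReg a (1 - p) z =
      (ascPochhammer ℂ p).eval a * z ^ p * kummerReg (a + p) (1 + p) z := by
  have h := (summable_kummerReg a (1 - p) z).hasSum
  have h1 : HasSum (fun n : ℕ => kummerCoeff a (1 - p) n * z ^ n)
      ((ascPochhammer ℂ p).eval a * z ^ p * kummerReg (a + p) (1 + p) z) := by
    rw [← hasSum_nat_add_iff' p]
    have h2 : ∑ n ∈ Finset.range p, kummerCoeff a (1 - p) n * z ^ n = 0 := by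
      refine Finset.sum_eq_zero fun n hn => ?_
      have hn' := Finset.mem_range.1 hn
      have h3 : (1 : ℂ) - p + n = -((p - 1 - n : ℕ) : ℂ) := by
        rw [Nat.cast_sub (by omega), Nat.cast_sub (by omega)]
        push_cast
        ring
      rw [kummerCoeff, h3, Complex.Gamma_neg_nat_eq_zero]
      simp
    rw [h2, sub_zero]
    refine ((summable_kummerReg (a + p) (1 + p) z).hasSum.mul_left
      ((ascPochhammer ℂ p).eval a * z ^ p)).congr_fun fun n => ?_
    have h4 : (1 : ℂ) - p + ((n + p : ℕ) : ℂ) = n + 1 := by push_cast; ring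
    have h5 : (1 : ℂ) + p + n = ((n + p : ℕ) : ℂ) + 1 := by push_cast; ring
    have h6 : (ascPochhammer ℂ (n + p)).eval a =
        (ascPochhammer ℂ p).eval a * (ascPochhammer ℂ n).eval (a + p) := by
      rw [add_comm n p, ← ascPochhammer_mul]
      simp
    simp only [kummerCoeff, h4, h5, h6, Complex.Gamma_nat_eq_factorial]
    ring
  exact h.unique h1

/-- The two regularized Kummer solutions become proportional when `b` is an integer. -/
theorem kummerReg_one_sub_nat_mul_inv_Gamma (a z : ℂ) (p : ℕ) :
    kummerReg a (1 - p) z * (Gamma (a + p))⁻¹ =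
      z ^ p * kummerReg (a + p) (1 + p) z * (Gamma a)⁻¹ := by
  rw [kummerReg_one_sub_nat, inv_Gamma_eq_ascPochhammer_mul a p]
  ring

/-! ### Whittaker's equation in the logarithmic variable -/

/-- The coefficient of the Whittaker equation `f'' = f' + q f` in the variable `w`, `z = exp w`. -/
noncomputable def whittakerPotential (κ μ w : ℂ) : ℂ :=
  exp w ^ 2 / 4 - κ * exp w + μ ^ 2 - 1 / 4

/-- The regularized Whittaker function `M_{κ,μ}(z) / Γ(1+2μ)` at `z = exp w`. -/
noncomputable def whittakerMReg (κ μ w : ℂ) : ℂ :=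
  exp (-exp w / 2 + (1 / 2 + μ) * w) * kummerReg (1 / 2 + μ - κ) (1 + 2 * μ) (exp w)

/-- The derivative of `whittakerMReg κ μ`. -/
noncomputable def whittakerMRegDeriv (κ μ w : ℂ) : ℂ :=
  exp (-exp w / 2 + (1 / 2 + μ) * w) *
    ((-exp w / 2 + (1 / 2 + μ)) * kummerReg (1 / 2 + μ - κ) (1 + 2 * μ) (exp w) +
      exp w * ((1 / 2 + μ - κ) * kummerReg (1 / 2 + μ - κ + 1) (1 + 2 * μ + 1) (exp w)))

theorem hasDerivAt_whittakerMReg (κ μ w : ℂ) :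
    HasDerivAt (whittakerMReg κ μ) (whittakerMRegDeriv κ μ w) w := by
  have he := Complex.hasDerivAt_exp w
  have h1 : HasDerivAt (fun w => -exp w / 2 + (1 / 2 + μ) * w) (-exp w / 2 + (1 / 2 + μ)) w := by
    simpa using (he.fun_neg.div_const 2).fun_add ((hasDerivAt_id w).const_mul (1 / 2 + μ))
  have h2 := (hasDerivAt_kummerReg (1 / 2 + μ - κ) (1 + 2 * μ) (exp w)).comp w he
  refine (h1.cexp.mul h2).congr_deriv ?_
  simp only [whittakerMRegDeriv, Function.comp]
  ring

theorem hasDerivAt_whittakerMRegDeriv (κ μ w : ℂ) :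
    HasDerivAt (whittakerMRegDeriv κ μ)
      (whittakerMRegDeriv κ μ w + whittakerPotential κ μ w * whittakerMReg κ μ w) w := by
  have he := Complex.hasDerivAt_exp w
  have h0 : HasDerivAt (fun w => -exp w / 2 + (1 / 2 + μ)) (-exp w / 2) w := by
    simpa using (he.neg.div_const 2).add_const (1 / 2 + μ)
  have h1 : HasDerivAt (fun w => -exp w / 2 + (1 / 2 + μ) * w) (-exp w / 2 + (1 / 2 + μ)) w := by
    simpa using (he.fun_neg.div_const 2).fun_add ((hasDerivAt_id w).const_mul (1 / 2 + μ))
  have h2 := (hasDerivAt_kummerReg (1 / 2 + μ - κ) (1 + 2 * μ) (exp w)).comp w he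
  have h3 := (hasDerivAt_kummerReg (1 / 2 + μ - κ + 1) (1 + 2 * μ + 1) (exp w)).comp w he
  have h := h1.cexp.mul ((h0.mul h2).add (he.mul (h3.const_mul (1 / 2 + μ - κ))))
  refine h.congr_deriv ?_
  simp only [whittakerMRegDeriv, whittakerMReg, whittakerPotential, Function.comp, Pi.mul_apply,
    Pi.add_apply]
  -- After removal of the exponential prefactor, the Whittaker equation is `exp w` times Kummer's
  -- equation.
  linear_combination exp (-exp w / 2 + (1 / 2 + μ) * w) * exp w *
    kummerReg_ode (1 / 2 + μ - κ) (1 + 2 * μ) (exp w)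

theorem continuous_whittakerMReg (κ : ℂ) :
    Continuous fun p : ℂ × ℂ => whittakerMReg κ p.1 p.2 := by
  have h : Continuous fun p : ℂ × ℂ =>
      kummerReg (1 / 2 + p.1 - κ) (1 + 2 * p.1) (exp p.2) :=
    continuous_kummerReg.comp
      (f := fun p : ℂ × ℂ => (1 / 2 + p.1 - κ, 1 + 2 * p.1, exp p.2)) (by fun_prop)
  unfold whittakerMReg
  fun_prop

theorem continuous_whittakerMRegDeriv (κ : ℂ) :
    Continuous fun p : ℂ × ℂ => whittakerMRegDeriv κ p.1 p.2 := by
  have h : Continuous fun p : ℂ × ℂ =>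
      kummerReg (1 / 2 + p.1 - κ) (1 + 2 * p.1) (exp p.2) :=
    continuous_kummerReg.comp
      (f := fun p : ℂ × ℂ => (1 / 2 + p.1 - κ, 1 + 2 * p.1, exp p.2)) (by fun_prop)
  have h' : Continuous fun p : ℂ × ℂ =>
      kummerReg (1 / 2 + p.1 - κ + 1) (1 + 2 * p.1 + 1) (exp p.2) :=
    continuous_kummerReg.comp
      (f := fun p : ℂ × ℂ => (1 / 2 + p.1 - κ + 1, 1 + 2 * p.1 + 1, exp p.2)) (by fun_prop)
  unfold whittakerMRegDeriv
  fun_prop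

theorem differentiable_whittakerMReg (κ w : ℂ) :
    Differentiable ℂ fun μ => whittakerMReg κ μ w := by
  have h : Differentiable ℂ fun μ : ℂ => kummerReg (1 / 2 + μ - κ) (1 + 2 * μ) (exp w) :=
    differentiable_kummerReg (by fun_prop) (by fun_prop) (by fun_prop)
  unfold whittakerMReg
  fun_prop

/-! ### Holomorphy of `W` in the parameter `μ` -/

/-- `whittakerW κ μ w` is `π / sin (2πμ)` times this function, see `whittakerW_of_sin_ne_zero`. -/
noncomputable def whittakerNum (κ μ w : ℂ) : ℂ :=
  whittakerMReg κ (-μ) w * (Gamma (1 / 2 + μ - κ))⁻¹ -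
    whittakerMReg κ μ w * (Gamma (1 / 2 - μ - κ))⁻¹

/-- The derivative of `whittakerNum κ μ`. -/
noncomputable def whittakerNumDeriv (κ μ w : ℂ) : ℂ :=
  whittakerMRegDeriv κ (-μ) w * (Gamma (1 / 2 + μ - κ))⁻¹ -
    whittakerMRegDeriv κ μ w * (Gamma (1 / 2 - μ - κ))⁻¹

theorem hasDerivAt_whittakerNum (κ μ w : ℂ) :
    HasDerivAt (whittakerNum κ μ) (whittakerNumDeriv κ μ w) w :=
  ((hasDerivAt_whittakerMReg κ (-μ) w).mul_const _).sub
    ((hasDerivAt_whittakerMReg κ μ w).mul_const _)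

theorem hasDerivAt_whittakerNumDeriv (κ μ w : ℂ) :
    HasDerivAt (whittakerNumDeriv κ μ)
      (whittakerNumDeriv κ μ w + whittakerPotential κ μ w * whittakerNum κ μ w) w := by
  refine HasDerivAt.congr_deriv (((hasDerivAt_whittakerMRegDeriv κ (-μ) w).mul_const (Gamma (1 / 2 + μ - κ))⁻¹).sub
    ((hasDerivAt_whittakerMRegDeriv κ μ w).mul_const (Gamma (1 / 2 - μ - κ))⁻¹)) ?_
  simp only [whittakerNumDeriv, whittakerNum, whittakerPotential]
  ring

theorem differentiable_inv_Gamma_add (κ : ℂ) :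
    Differentiable ℂ fun μ : ℂ => (Gamma (1 / 2 + μ - κ))⁻¹ :=
  differentiable_one_div_Gamma.comp (by fun_prop : Differentiable ℂ fun μ : ℂ => 1 / 2 + μ - κ)

theorem differentiable_inv_Gamma_sub (κ : ℂ) :
    Differentiable ℂ fun μ : ℂ => (Gamma (1 / 2 - μ - κ))⁻¹ :=
  differentiable_one_div_Gamma.comp (by fun_prop : Differentiable ℂ fun μ : ℂ => 1 / 2 - μ - κ)

theorem continuous_whittakerNum (κ : ℂ) :
    Continuous fun p : ℂ × ℂ => whittakerNum κ p.1 p.2 := by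
  have h1 := (differentiable_inv_Gamma_add κ).continuous.comp (continuous_fst (Y := ℂ))
  have h2 := (differentiable_inv_Gamma_sub κ).continuous.comp (continuous_fst (Y := ℂ))
  have h3 := continuous_whittakerMReg κ
  have h4 := h3.comp (f := fun p : ℂ × ℂ => (-p.1, p.2)) (by fun_prop)
  exact (h4.mul h1).sub (h3.mul h2)

theorem continuous_whittakerNumDeriv (κ : ℂ) :
    Continuous fun p : ℂ × ℂ => whittakerNumDeriv κ p.1 p.2 := by
  have h1 := (differentiable_inv_Gamma_add κ).continuous.comp (continuous_fst (Y := ℂ))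
  have h2 := (differentiable_inv_Gamma_sub κ).continuous.comp (continuous_fst (Y := ℂ))
  have h3 := continuous_whittakerMRegDeriv κ
  have h4 := h3.comp (f := fun p : ℂ × ℂ => (-p.1, p.2)) (by fun_prop)
  exact (h4.mul h1).sub (h3.mul h2)

theorem differentiable_whittakerNum (κ w : ℂ) :
    Differentiable ℂ fun μ => whittakerNum κ μ w := by
  have h1 := differentiable_whittakerMReg κ w
  have h2 := h1.comp (differentiable_id.neg)
  exact (h2.mul (differentiable_inv_Gamma_add κ)).sub (h1.mul (differentiable_inv_Gamma_sub κ))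

theorem whittakerNum_neg (κ μ w : ℂ) : whittakerNum κ (-μ) w = -whittakerNum κ μ w := by
  simp only [whittakerNum, neg_neg, ← sub_eq_add_neg, sub_neg_eq_add]
  ring

/-- When `2μ` is an integer the two regularized Kummer solutions are proportional, with exactly the
factor that makes the two terms cancel. These zeros compensate those of `sin (2πμ)`. -/
theorem whittakerNum_of_two_mul_eq_nat {κ μ : ℂ} {p : ℕ} (hp : 2 * μ = p) (w : ℂ) :
    whittakerNum κ μ w = 0 := by
  have h := kummerReg_one_sub_nat_mul_inv_Gamma (1 / 2 - μ - κ) (exp w) p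
  have h1 : exp (-exp w / 2 + (1 / 2 + μ) * w) =
      exp (-exp w / 2 + (1 / 2 - μ) * w) * exp w ^ p := by
    rw [← Complex.exp_nat_mul, ← Complex.exp_add, ← hp]
    ring_nf
  have h2 : 1 / 2 - μ - κ + p = 1 / 2 + μ - κ := by rw [← hp]; ring
  rw [h2, ← hp] at h
  simp only [whittakerNum, whittakerMReg, h1, mul_neg, ← sub_eq_add_neg]
  linear_combination exp (-exp w / 2 + (1 / 2 - μ) * w) * h

theorem whittakerNum_of_two_mul_eq_int {κ μ : ℂ} {p : ℤ} (hp : 2 * μ = p) (w : ℂ) :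
    whittakerNum κ μ w = 0 := by
  obtain ⟨q, rfl | rfl⟩ := p.eq_nat_or_neg
  · exact whittakerNum_of_two_mul_eq_nat (p := q) (by simpa using hp) w
  · rw [← neg_eq_zero, ← whittakerNum_neg]
    exact whittakerNum_of_two_mul_eq_nat (p := q) (by rw [mul_neg, hp]; simp) w

theorem sin_two_pi_mul_eq_zero_iff (μ : ℂ) :
    sin (2 * Real.pi * μ) = 0 ↔ ∃ p : ℤ, 2 * μ = p := by
  rw [Complex.sin_eq_zero_iff]
  have hpi : (Real.pi : ℂ) ≠ 0 := by exact_mod_cast Real.pi_ne_zero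
  refine exists_congr fun p => ⟨fun h => mul_right_cancel₀ hpi ?_, fun h => ?_⟩
  · rw [← h]; ring
  · rw [← h]; ring

theorem Gamma_mul_Gamma_one_add_neg (x : ℂ) :
    Gamma (-x) * Gamma (1 + x) = -(Real.pi / sin (Real.pi * x)) := by
  have h := Complex.Gamma_mul_Gamma_one_sub (-x)
  rw [sub_neg_eq_add, mul_neg, sin_neg, div_neg] at h
  exact h

/-- Euler's reflection formula combines the Gamma factors. No condition on `μ` is needed: if `2μ ∈
ℤ`, both sides are `0`, by the conventions for `Γ` at its poles and for division by `0`. -/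
theorem whittakerWGeneric_eq (κ μ w : ℂ) :
    whittakerWGeneric κ μ w = Real.pi / sin (2 * Real.pi * μ) * whittakerNum κ μ w := by
  have hM : ∀ ν, whittakerM κ ν w = Gamma (1 + 2 * ν) * whittakerMReg κ ν w := fun ν => by
    rw [whittakerM, kummerM, regularizedHGFun_eq_kummerReg, whittakerMReg, Complex.exp_add]
    ring
  have h1 := Gamma_mul_Gamma_one_add_neg (2 * μ)
  have h2 := Gamma_mul_Gamma_one_add_neg (-(2 * μ))
  rw [mul_neg, sin_neg, div_neg, neg_neg, neg_neg] at h2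
  have h3 : (Real.pi : ℂ) * (2 * μ) = 2 * Real.pi * μ := by ring
  rw [h3] at h1 h2
  rw [whittakerWGeneric, hM, hM, whittakerNum, neg_mul, mul_neg]
  linear_combination (Gamma (1 / 2 - μ - κ))⁻¹ * whittakerMReg κ μ w * h1 +
    (Gamma (1 / 2 + μ - κ))⁻¹ * whittakerMReg κ (-μ) w * h2

theorem whittakerW_of_sin_ne_zero {κ μ : ℂ} (h : sin (2 * Real.pi * μ) ≠ 0) (w : ℂ) :
    whittakerW κ μ w = Real.pi / sin (2 * Real.pi * μ) * whittakerNum κ μ w := by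
  rw [whittakerW, if_neg (mt (sin_two_pi_mul_eq_zero_iff μ).2 h), whittakerWGeneric_eq]

theorem hasDerivAt_sin_two_pi_mul (μ : ℂ) :
    HasDerivAt (fun ν : ℂ => sin (2 * Real.pi * ν)) (cos (2 * Real.pi * μ) * (2 * Real.pi)) μ := by
  simpa using ((hasDerivAt_id μ).const_mul (2 * Real.pi : ℂ)).csin

theorem cos_two_pi_mul_ne_zero {μ : ℂ} (h : sin (2 * Real.pi * μ) = 0) :
    cos (2 * Real.pi * μ) * (2 * Real.pi) ≠ 0 := by
  have h1 := Complex.sin_sq_add_cos_sq (2 * Real.pi * μ)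
  have hpi : (Real.pi : ℂ) ≠ 0 := by exact_mod_cast Real.pi_ne_zero
  intro h2
  have : cos (2 * Real.pi * μ) = 0 := by simpa [hpi] using h2
  simp [h, this] at h1

theorem eventually_sin_two_pi_mul_ne_zero (μ : ℂ) :
    ∀ᶠ ν in 𝓝[≠] μ, sin (2 * Real.pi * ν) ≠ 0 := by
  by_cases h : sin (2 * Real.pi * μ) = 0
  · exact (hasDerivAt_sin_two_pi_mul μ).eventually_ne (cos_two_pi_mul_ne_zero h)
  · exact ((hasDerivAt_sin_two_pi_mul μ).continuousAt.eventually_ne h).filter_mono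
      nhdsWithin_le_nhds

theorem differentiable_dslope {f : ℂ → ℂ} (hf : Differentiable ℂ f) (c : ℂ) :
    Differentiable ℂ (dslope f c) := by
  rw [← differentiableOn_univ] at hf ⊢
  exact (Complex.differentiableOn_dslope univ_mem).2 hf

theorem differentiable_whittakerW (κ w : ℂ) : Differentiable ℂ fun μ => whittakerW κ μ w := by
  intro μ
  by_cases h : sin (2 * Real.pi * μ) = 0
  · set f : ℂ → ℂ := fun ν => whittakerNum κ ν w with hf
    set s : ℂ → ℂ := fun ν => sin (2 * Real.pi * ν) with hs
    have hfμ : f μ = 0 := by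
      obtain ⟨p, hp⟩ := (sin_two_pi_mul_eq_zero_iff μ).1 h
      exact whittakerNum_of_two_mul_eq_int hp w
    have hfd : Differentiable ℂ f := differentiable_whittakerNum κ w
    have hsd : Differentiable ℂ s := fun ν => (hasDerivAt_sin_two_pi_mul ν).differentiableAt
    have hs0 : dslope s μ μ ≠ 0 := by
      rw [dslope_same, (hasDerivAt_sin_two_pi_mul μ).deriv]
      exact cos_two_pi_mul_ne_zero h
    -- Numerator and sine both vanish at `μ`, and the zero of the sine is simple. Dividing each by
    -- `ν - μ` gives the holomorphic extension, whose value at `μ` is the limit defining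
    -- `whittakerW`.
    have hg : DifferentiableAt ℂ (fun ν => Real.pi * (dslope f μ ν / dslope s μ ν)) μ :=
      ((differentiable_dslope hfd μ μ).div (differentiable_dslope hsd μ μ) hs0).const_mul _
    have hgen : ∀ᶠ ν in 𝓝[≠] μ, Real.pi * (dslope f μ ν / dslope s μ ν) =
        whittakerWGeneric κ ν w := by
      filter_upwards [self_mem_nhdsWithin] with ν hν
      have hν' : ν - μ ≠ 0 := sub_ne_zero.2 hν
      rw [whittakerWGeneric_eq, dslope_of_ne _ hν, dslope_of_ne _ hν, slope_def_field,
        slope_def_field, hfμ, show s μ = 0 from h, sub_zero, sub_zero, div_div_div_cancel_right₀ hν']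
      simp only [hf, hs]
      ring
    have hlim : Tendsto (fun ν => whittakerWGeneric κ ν w) (𝓝[≠] μ)
        (𝓝 (Real.pi * (dslope f μ μ / dslope s μ μ))) :=
      (hg.continuousAt.tendsto.mono_left nhdsWithin_le_nhds).congr' hgen
    refine hg.congr_of_eventuallyEq ?_
    rw [← nhdsNE_sup_pure μ]
    refine eventually_sup.2 ⟨?_, ?_⟩
    · filter_upwards [hgen, eventually_sin_two_pi_mul_ne_zero μ] with ν h1 h2
      rw [h1, whittakerW_of_sin_ne_zero h2, whittakerWGeneric_eq]
    · change whittakerW κ μ w = _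
      rw [whittakerW, if_pos ((sin_two_pi_mul_eq_zero_iff μ).1 h), hlim.limUnder_eq]
  · have hc := (hasDerivAt_sin_two_pi_mul μ).continuousAt.eventually_ne h
    refine DifferentiableAt.congr_of_eventuallyEq ?_
      (hc.mono fun ν hν => whittakerW_of_sin_ne_zero hν w)
    exact ((differentiableAt_const _).div (hasDerivAt_sin_two_pi_mul μ).differentiableAt h).mul
      (differentiable_whittakerNum κ w μ)

/-! ### Contour integrals and the `μ`-derivatives of `W` -/

theorem hasDerivAt_circleIntegral_mul {c : ℂ → ℂ} {μ : ℂ} {r : ℝ} (hr : 0 ≤ r)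
    (hc : ContinuousOn c (Metric.sphere μ r)) {G G' : ℂ → ℂ → ℂ}
    (hG : Continuous fun p : ℂ × ℂ => G p.1 p.2) (hG' : Continuous fun p : ℂ × ℂ => G' p.1 p.2)
    (hd : ∀ ν w, HasDerivAt (G ν) (G' ν w) w) (w : ℂ) :
    HasDerivAt (fun w => ∮ ν in C(μ, r), c ν * G ν w) (∮ ν in C(μ, r), c ν * G' ν w) w := by
  have hcc : Continuous fun θ : ℝ => c (circleMap μ r θ) :=
    hc.comp_continuous (continuous_circleMap μ r) fun θ => circleMap_mem_sphere μ hr θ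
  have hdc : Continuous fun θ : ℝ => deriv (circleMap μ r) θ := by
    simp only [deriv_circleMap]
    fun_prop
  have key : ∀ {H : ℂ → ℂ → ℂ}, (Continuous fun p : ℂ × ℂ => H p.1 p.2) →
      Continuous fun p : ℂ × ℝ =>
        deriv (circleMap μ r) p.2 • (c (circleMap μ r p.2) * H (circleMap μ r p.2) p.1) := by
    intro H hH
    have h1 : Continuous fun p : ℂ × ℝ => H (circleMap μ r p.2) p.1 :=
      hH.comp (((continuous_circleMap μ r).comp continuous_snd).prodMk continuous_fst)
    exact (hdc.comp continuous_snd).smul ((hcc.comp continuous_snd).mul h1)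
  have hslice : ∀ {H : ℂ → ℂ → ℂ}, (Continuous fun p : ℂ × ℂ => H p.1 p.2) → ∀ x : ℂ,
      Continuous fun θ : ℝ =>
        deriv (circleMap μ r) θ • (c (circleMap μ r θ) * H (circleMap μ r θ) x) :=
    fun hH x => (key hH).comp (continuous_const.prodMk continuous_id)
  have hK : IsCompact (Metric.closedBall w 1 ×ˢ Set.uIcc (0 : ℝ) (2 * Real.pi)) :=
    (isCompact_closedBall _ _).prod isCompact_uIcc
  -- Joint continuity on a compact set gives a constant dominating function.
  obtain ⟨B, hB⟩ := hK.exists_bound_of_continuousOn (key hG').continuousOn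
  refine (intervalIntegral.hasDerivAt_integral_of_dominated_loc_of_deriv_le
    (bound := fun _ => B) (Metric.closedBall_mem_nhds w one_pos)
    (.of_forall fun x => (hslice hG x).aestronglyMeasurable)
    ((hslice hG w).intervalIntegrable _ _) (hslice hG' w).aestronglyMeasurable
    (.of_forall fun θ hθ x hx => hB (x, θ) ⟨hx, Set.uIoc_subset_uIcc hθ⟩)
    intervalIntegrable_const (.of_forall fun θ _ x _ => ?_)).2
  exact ((hd _ x).const_mul _).const_mul (deriv (circleMap μ r) θ)

theorem exists_sphere_sin_ne_zero (μ : ℂ) : ∃ r > 0, ∀ ν ∈ Metric.closedBall μ r, ν ≠ μ →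
    sin (2 * Real.pi * ν) ≠ 0 := by
  obtain ⟨r, hr, h⟩ := Metric.nhds_basis_closedBall.mem_iff.1
    (eventually_nhdsWithin_iff.1 (eventually_sin_two_pi_mul_ne_zero μ))
  exact ⟨r, hr, fun ν hν hne => h hν hne⟩

theorem continuousOn_pi_div_sin {μ : ℂ} {r : ℝ}
    (h : ∀ ν ∈ Metric.sphere μ r, sin (2 * Real.pi * ν) ≠ 0) :
    ContinuousOn (fun ν : ℂ => Real.pi / sin (2 * Real.pi * ν)) (Metric.sphere μ r) :=
  continuousOn_const.div (by fun_prop) h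

/-- The circle integral of `c · W_{κ,·}`, expressed through `whittakerNum`. -/
noncomputable def whittakerCircle (κ μ : ℂ) (r : ℝ) (c : ℂ → ℂ) (w : ℂ) : ℂ :=
  ∮ ν in C(μ, r), c ν * (Real.pi / sin (2 * Real.pi * ν)) * whittakerNum κ ν w

/-- The derivative of `whittakerCircle κ μ r c`. -/
noncomputable def whittakerCircleDeriv (κ μ : ℂ) (r : ℝ) (c : ℂ → ℂ) (w : ℂ) : ℂ :=
  ∮ ν in C(μ, r), c ν * (Real.pi / sin (2 * Real.pi * ν)) * whittakerNumDeriv κ ν w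

section

variable {κ μ : ℂ} {r : ℝ} {c : ℂ → ℂ}

theorem hasDerivAt_whittakerCircle (hr : 0 ≤ r)
    (h : ∀ ν ∈ Metric.sphere μ r, sin (2 * Real.pi * ν) ≠ 0)
    (hc : ContinuousOn c (Metric.sphere μ r)) (w : ℂ) :
    HasDerivAt (whittakerCircle κ μ r c) (whittakerCircleDeriv κ μ r c w) w :=
  hasDerivAt_circleIntegral_mul hr (hc.mul (continuousOn_pi_div_sin h)) (continuous_whittakerNum κ)
    (continuous_whittakerNumDeriv κ) (hasDerivAt_whittakerNum κ) w

/-- The potential at `ν` is the potential at `0` plus `ν²`. The first part leaves the integral, and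
`ν²` is absorbed into the weight `c`. -/
theorem hasDerivAt_whittakerCircleDeriv (hr : 0 ≤ r)
    (h : ∀ ν ∈ Metric.sphere μ r, sin (2 * Real.pi * ν) ≠ 0)
    (hc : ContinuousOn c (Metric.sphere μ r)) (w : ℂ) :
    HasDerivAt (whittakerCircleDeriv κ μ r c)
      (whittakerCircleDeriv κ μ r c w + whittakerPotential κ 0 w * whittakerCircle κ μ r c w +
        whittakerCircle κ μ r (fun ν => ν ^ 2 * c ν) w) w := by
  have hs := hc.mul (continuousOn_pi_div_sin h)
  have hN := continuous_whittakerNum κ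
  have hN' := continuous_whittakerNumDeriv κ
  have hN'' : Continuous fun p : ℂ × ℂ => whittakerNumDeriv κ p.1 p.2 +
      whittakerPotential κ p.1 p.2 * whittakerNum κ p.1 p.2 := by
    have hq : Continuous fun p : ℂ × ℂ => whittakerPotential κ p.1 p.2 := by
      unfold whittakerPotential
      fun_prop
    exact hN'.add (hq.mul hN)
  refine HasDerivAt.congr_deriv (hasDerivAt_circleIntegral_mul (G := whittakerNumDeriv κ)
    (G' := fun ν w => whittakerNumDeriv κ ν w + whittakerPotential κ ν w * whittakerNum κ ν w)
    hr hs hN' hN'' (hasDerivAt_whittakerNumDeriv κ) w) ?_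
  have hNw : Continuous fun ν => whittakerNum κ ν w :=
    (differentiable_whittakerNum κ w).continuous
  have hNw' : Continuous fun ν => whittakerNumDeriv κ ν w :=
    hN'.comp (f := fun ν : ℂ => (ν, w)) (by fun_prop)
  have i1 : CircleIntegrable
      (fun ν => c ν * (Real.pi / sin (2 * Real.pi * ν)) * whittakerNumDeriv κ ν w) μ r :=
    (hs.mul hNw'.continuousOn).circleIntegrable hr
  have i2 : CircleIntegrable (fun ν => whittakerPotential κ 0 w *
      (c ν * (Real.pi / sin (2 * Real.pi * ν)) * whittakerNum κ ν w)) μ r :=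
    (continuousOn_const.mul (hs.mul hNw.continuousOn)).circleIntegrable hr
  have i12 : CircleIntegrable (fun ν =>
      c ν * (Real.pi / sin (2 * Real.pi * ν)) * whittakerNumDeriv κ ν w +
        whittakerPotential κ 0 w *
          (c ν * (Real.pi / sin (2 * Real.pi * ν)) * whittakerNum κ ν w)) μ r := i1.add i2
  have i3 : CircleIntegrable (fun ν =>
      ν ^ 2 * c ν * (Real.pi / sin (2 * Real.pi * ν)) * whittakerNum κ ν w) μ r := by
    refine (ContinuousOn.mul (ContinuousOn.mul ?_ (continuousOn_pi_div_sin h))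
      hNw.continuousOn).circleIntegrable hr
    exact (continuous_pow 2).continuousOn.mul hc
  simp only [whittakerCircle, whittakerCircleDeriv]
  rw [← circleIntegral.integral_const_mul, ← circleIntegral.integral_add i1 i2,
    ← circleIntegral.integral_add i12 i3]
  congr 1
  ext ν
  simp only [whittakerPotential, Pi.mul_apply]
  ring

theorem whittakerCircle_eq (hr : 0 ≤ r) (h : ∀ ν ∈ Metric.sphere μ r, sin (2 * Real.pi * ν) ≠ 0)
    (w : ℂ) : whittakerCircle κ μ r c w = ∮ ν in C(μ, r), c ν * whittakerW κ ν w :=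
  circleIntegral.integral_congr hr fun ν hν => by
    simp only [whittakerW_of_sin_ne_zero (h ν hν)]
    ring

end

/-- The `j`-th derivative in `μ` of `W_{κ,μ}(exp w)`. -/
noncomputable def whittakerJet (κ μ : ℂ) (j : ℕ) (w : ℂ) : ℂ :=
  iteratedDeriv j (fun ν => whittakerW κ ν w) μ

theorem whittakerJet_eq_circle {κ μ : ℂ} {r : ℝ} (hr : 0 < r)
    (h : ∀ ν ∈ Metric.sphere μ r, sin (2 * Real.pi * ν) ≠ 0) (j : ℕ) (w : ℂ) :
    whittakerJet κ μ j w = j.factorial * (2 * Real.pi * I)⁻¹ *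
      whittakerCircle κ μ r (fun ν => 1 / (ν - μ) ^ (j + 1)) w := by
  have h1 := (differentiable_whittakerW κ w).differentiableOn
    (s := Metric.closedBall μ r) |>.circleIntegral_one_div_sub_center_pow_smul hr j
  simp only [smul_eq_mul] at h1
  rw [whittakerCircle_eq hr.le h, h1, whittakerJet]
  have h2 : (j.factorial : ℂ) ≠ 0 := by exact_mod_cast j.factorial_ne_zero
  have h3 := Complex.two_pi_I_ne_zero
  field_simp

theorem iteratedDeriv_id_mul {f : ℂ → ℂ} (hf : Differentiable ℂ f) (j : ℕ) :
    iteratedDeriv j (fun ν => ν * f ν) =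
      fun ν => ν * iteratedDeriv j f ν + j * iteratedDeriv (j - 1) f ν := by
  have hd : ∀ i, Differentiable ℂ (iteratedDeriv i f) := fun i =>
    hf.contDiff.differentiable_iteratedDeriv i (WithTop.coe_lt_top _)
  induction j with
  | zero => simp
  | succ j ih =>
    rw [iteratedDeriv_succ, ih]
    ext ν
    have h1 : ∀ i, HasDerivAt (iteratedDeriv i f) (iteratedDeriv (i + 1) f ν) ν := fun i => by
      rw [iteratedDeriv_succ]
      exact (hd i ν).hasDerivAt
    rw [(((hasDerivAt_id' ν).fun_mul (h1 j)).fun_add ((h1 (j - 1)).const_mul (j : ℂ))).deriv]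
    cases j with
    | zero => simp; ring
    | succ j => simp only [Nat.add_sub_cancel]; push_cast; ring

/-- This is Whittaker's equation differentiated `j` times in `μ`. Cauchy's formula replaces the
`μ`-derivatives by circle integrals, which may be differentiated in `w` under the integral sign. The
truncated indices `j - 1` and `j - 2` are harmless, since their coefficients vanish wherever
truncation occurs. -/
theorem exists_hasDerivAt_whittakerJet (κ μ : ℂ) : ∃ D : ℕ → ℂ → ℂ,
    (∀ j w, HasDerivAt (whittakerJet κ μ j) (D j w) w) ∧
    ∀ j w, HasDerivAt (D j) (D j w + whittakerPotential κ μ w * whittakerJet κ μ j w +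
      2 * j * μ * whittakerJet κ μ (j - 1) w +
      j * (j - 1) * whittakerJet κ μ (j - 2) w) w := by
  obtain ⟨r, hr, hball⟩ := exists_sphere_sin_ne_zero μ
  have hsph : ∀ ν ∈ Metric.sphere μ r, ν - μ ≠ 0 := fun ν hν hne => by
    rw [sub_eq_zero.1 hne, Metric.mem_sphere, dist_self] at hν
    exact hr.ne hν
  have h : ∀ ν ∈ Metric.sphere μ r, sin (2 * Real.pi * ν) ≠ 0 := fun ν hν =>
    hball ν (Metric.sphere_subset_closedBall hν) (sub_ne_zero.1 (hsph ν hν))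
  have hc : ∀ j : ℕ, ContinuousOn (fun ν => 1 / (ν - μ) ^ (j + 1)) (Metric.sphere μ r) := fun j =>
    continuousOn_const.div (by fun_prop) fun ν hν => pow_ne_zero _ (hsph ν hν)
  have hjet := fun j => funext (whittakerJet_eq_circle (κ := κ) hr h j)
  refine ⟨fun j w => j.factorial * (2 * Real.pi * I)⁻¹ *
    whittakerCircleDeriv κ μ r (fun ν => 1 / (ν - μ) ^ (j + 1)) w, fun j w => ?_, fun j w => ?_⟩
  · rw [hjet]
    exact (hasDerivAt_whittakerCircle hr.le h (hc j) w).const_mul _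
  · refine ((hasDerivAt_whittakerCircleDeriv hr.le h (hc j) w).const_mul _).congr_deriv ?_
    -- The weight `ν²` turns the integral into the `j`-th derivative of `ν² W`, which two
    -- applications of the Leibniz rule for multiplication by `ν` expand.
    have hsq : j.factorial * (2 * Real.pi * I)⁻¹ *
        whittakerCircle κ μ r (fun ν => ν ^ 2 * (1 / (ν - μ) ^ (j + 1))) w =
        μ ^ 2 * whittakerJet κ μ j w + 2 * j * μ * whittakerJet κ μ (j - 1) w +
          j * (j - 1) * whittakerJet κ μ (j - 2) w := by
      have hW := differentiable_whittakerW κ w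
      have h1 := ((differentiable_fun_id.fun_mul (differentiable_fun_id.fun_mul hW)).differentiableOn
        (s := Metric.closedBall μ r)).circleIntegral_one_div_sub_center_pow_smul hr j
      have h2 : iteratedDeriv j (fun ν => ν * (ν * whittakerW κ ν w)) μ =
          μ ^ 2 * whittakerJet κ μ j w + 2 * j * μ * whittakerJet κ μ (j - 1) w +
            j * (j - 1) * whittakerJet κ μ (j - 2) w := by
        rw [iteratedDeriv_id_mul (differentiable_fun_id.fun_mul hW)]
        simp only [iteratedDeriv_id_mul hW, whittakerJet]
        rw [show j - 1 - 1 = j - 2 by omega]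
        cases j with
        | zero => simp; ring
        | succ j => simp only [Nat.add_sub_cancel]; push_cast; ring
      rw [← h2, whittakerCircle_eq hr.le h]
      have h3 : (∮ ν in C(μ, r), ν ^ 2 * (1 / (ν - μ) ^ (j + 1)) * whittakerW κ ν w) =
          (2 * Real.pi * I / j.factorial) *
            iteratedDeriv j (fun ν => ν * (ν * whittakerW κ ν w)) μ := by
        refine Eq.trans ?_ h1
        congr 1
        ext ν
        simp only [smul_eq_mul]
        ring
      rw [h3]
      have h4 : (j.factorial : ℂ) ≠ 0 := by exact_mod_cast j.factorial_ne_zero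
      have h5 := Complex.two_pi_I_ne_zero
      field_simp
    have hpot : whittakerPotential κ μ w = whittakerPotential κ 0 w + μ ^ 2 := by
      simp only [whittakerPotential]; ring
    rw [mul_add, mul_add, hsq, hpot]
    simp only [whittakerJet_eq_circle (κ := κ) hr h j]
    ring

/-! ### The Wronskian of the two Whittaker solutions -/

/-- Abel's identity for `f'' = f' + q f`; the function `E` is the exponential. -/
theorem wronskian_eq_mul {𝕜 : Type*} [RCLike 𝕜] [NormedAlgebra 𝕜 ℂ]
    {f f' g g' q E : 𝕜 → ℂ}
    (hf : ∀ x, HasDerivAt f (f' x) x) (hf' : ∀ x, HasDerivAt f' (f' x + q x * f x) x)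
    (hg : ∀ x, HasDerivAt g (g' x) x) (hg' : ∀ x, HasDerivAt g' (g' x + q x * g x) x)
    (hE : ∀ x, HasDerivAt E (E x) x) (hE0 : ∀ x, E x ≠ 0) :
    ∃ C : ℂ, ∀ x, f x * g' x - f' x * g x = C * E x := by
  have hd : ∀ x, HasDerivAt (fun x => (f x * g' x - f' x * g x) / E x) 0 x := fun x => by
    refine ((((hf x).fun_mul (hg' x)).fun_sub ((hf' x).fun_mul (hg x))).fun_div (hE x)
      (hE0 x)).congr_deriv ?_
    rw [div_eq_zero_iff]
    left
    ring
  refine ⟨(f 0 * g' 0 - f' 0 * g 0) / E 0, fun x => ?_⟩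
  have h := is_const_of_deriv_eq_zero (fun x => (hd x).differentiableAt) (fun x => (hd x).deriv) x 0
  rw [← h, div_mul_cancel₀ _ (hE0 x)]

/-- The shift by `πi` changes the sign of `exp w`, which undoes that of `κ`; hence `W_{-κ,μ}(z
e^{πi})` solves the same equation as `W_{κ,μ}(z)`. -/
theorem whittakerPotential_neg (κ μ w : ℂ) :
    whittakerPotential (-κ) μ (w + Real.pi * I) = whittakerPotential κ μ w := by
  simp only [whittakerPotential, exp_add_pi_mul_I]
  ring

/-- The Wronskian of `M_{κ,μ}(z)` and `M_{-κ,ν}(z e^{πi})`, regularized. -/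
noncomputable def whittakerMRegWronskian (κ μ ν w : ℂ) : ℂ :=
  whittakerMReg κ μ w * whittakerMRegDeriv (-κ) ν (w + Real.pi * I) -
    whittakerMRegDeriv κ μ w * whittakerMReg (-κ) ν (w + Real.pi * I)

theorem exists_whittakerMRegWronskian_eq (κ : ℂ) {μ ν : ℂ} (h : μ ^ 2 = ν ^ 2) :
    ∃ C : ℂ, ∀ w, whittakerMRegWronskian κ μ ν w = C * exp w := by
  refine wronskian_eq_mul (q := whittakerPotential κ μ) (E := exp) (hasDerivAt_whittakerMReg κ μ)
    (hasDerivAt_whittakerMRegDeriv κ μ) (fun w => (hasDerivAt_whittakerMReg _ _ _).comp_add_const _ _)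
    (fun w => ?_) Complex.hasDerivAt_exp Complex.exp_ne_zero
  have hq : whittakerPotential κ μ w = whittakerPotential (-κ) ν (w + Real.pi * I) := by
    rw [whittakerPotential_neg, whittakerPotential, whittakerPotential, h]
  rw [hq]
  exact (hasDerivAt_whittakerMRegDeriv (-κ) ν (w + Real.pi * I)).comp_add_const _ _

theorem exp_whittaker_add_two_pi_mul_I (μ w : ℂ) :
    exp (-exp (w + 2 * Real.pi * I) / 2 + (1 / 2 + μ) * (w + 2 * Real.pi * I)) =
      exp ((1 / 2 + μ) * (2 * Real.pi * I)) * exp (-exp w / 2 + (1 / 2 + μ) * w) := by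
  rw [Complex.exp_periodic w, ← Complex.exp_add]
  ring_nf

theorem whittakerMReg_add_two_pi_mul_I (κ μ w : ℂ) :
    whittakerMReg κ μ (w + 2 * Real.pi * I) =
      exp ((1 / 2 + μ) * (2 * Real.pi * I)) * whittakerMReg κ μ w := by
  rw [whittakerMReg, exp_whittaker_add_two_pi_mul_I, Complex.exp_periodic w, whittakerMReg]
  ring

theorem whittakerMRegDeriv_add_two_pi_mul_I (κ μ w : ℂ) :
    whittakerMRegDeriv κ μ (w + 2 * Real.pi * I) =
      exp ((1 / 2 + μ) * (2 * Real.pi * I)) * whittakerMRegDeriv κ μ w := by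
  rw [whittakerMRegDeriv, exp_whittaker_add_two_pi_mul_I, Complex.exp_periodic w,
    whittakerMRegDeriv]
  ring

/-- A monodromy argument. By Abel's identity the Wronskian is `C exp w`, hence `2πi`-periodic, while
going once around `0` multiplies it by `e^{4πiμ}`, which is not `1` because `2μ ∉ ℤ`. -/
theorem whittakerMRegWronskian_self (κ : ℂ) {μ : ℂ} (hμ : sin (2 * Real.pi * μ) ≠ 0) (w : ℂ) :
    whittakerMRegWronskian κ μ μ w = 0 := by
  obtain ⟨C, hC⟩ := exists_whittakerMRegWronskian_eq κ (rfl : μ ^ 2 = μ ^ 2)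
  have h1 := hC (w + 2 * Real.pi * I)
  have hcomm : w + 2 * Real.pi * I + Real.pi * I = w + Real.pi * I + 2 * Real.pi * I := by ring
  have h2 : whittakerMRegWronskian κ μ μ (w + 2 * Real.pi * I) =
      exp ((1 / 2 + μ) * (2 * Real.pi * I)) ^ 2 * whittakerMRegWronskian κ μ μ w := by
    simp only [whittakerMRegWronskian, hcomm, whittakerMReg_add_two_pi_mul_I,
      whittakerMRegDeriv_add_two_pi_mul_I]
    ring
  rw [Complex.exp_periodic w, ← hC w, h2, ← Complex.exp_nat_mul] at h1
  have h3 : exp (((2 : ℕ) : ℂ) * ((1 / 2 + μ) * (2 * Real.pi * I))) ≠ 1 := by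
    intro h
    obtain ⟨p, hp⟩ := Complex.exp_eq_one_iff.1 h
    refine hμ ((sin_two_pi_mul_eq_zero_iff μ).2 ⟨p - 1, ?_⟩)
    have := mul_right_cancel₀ Complex.two_pi_I_ne_zero
      (show (((2 : ℕ) : ℂ) * (1 / 2 + μ)) * (2 * Real.pi * I) = p * (2 * Real.pi * I) by
        rw [← hp]; ring)
    push_cast at this ⊢
    linear_combination this
  have h4 : (exp (((2 : ℕ) : ℂ) * ((1 / 2 + μ) * (2 * Real.pi * I))) - 1) *
      whittakerMRegWronskian κ μ μ w = 0 := by linear_combination h1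
  exact (mul_eq_zero.1 h4).resolve_left (sub_ne_zero.2 h3)

theorem inv_Gamma_mul_inv_Gamma_one_sub (x : ℂ) :
    (Gamma x)⁻¹ * (Gamma (1 - x))⁻¹ = sin (Real.pi * x) / Real.pi := by
  rw [← mul_inv, Complex.Gamma_mul_Gamma_one_sub, inv_div]

/-- The constant in Abel's identity is read off at `z = 0`: here the exponents `1/2 ± μ` add up to
`1`, so the powers of `z` cancel against `exp w` and leave a function continuous at `0`. -/
theorem whittakerMRegWronskian_neg (κ μ w : ℂ) :
    whittakerMRegWronskian κ μ (-μ) w =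
      -(sin (2 * Real.pi * μ) / Real.pi) * exp ((1 / 2 - μ) * (Real.pi * I)) * exp w := by
  obtain ⟨C, hC⟩ := exists_whittakerMRegWronskian_eq κ (neg_sq μ).symm
  let R₁ := kummerReg (1 / 2 + μ - κ) (1 + 2 * μ)
  let R₁' := kummerReg (1 / 2 + μ - κ + 1) (1 + 2 * μ + 1)
  let R₂ := kummerReg (1 / 2 + -μ - -κ) (1 + 2 * -μ)
  let R₂' := kummerReg (1 / 2 + -μ - -κ + 1) (1 + 2 * -μ + 1)
  have hR : ∀ a b, Continuous (kummerReg a b) := fun a b =>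
    (differentiable_kummerReg (differentiable_const a) (differentiable_const b)
      differentiable_id).continuous
  let H : ℂ → ℂ := fun z =>
    R₁ z * ((z / 2 + (1 / 2 - μ)) * R₂ (-z) - z * ((1 / 2 + -μ - -κ) * R₂' (-z))) -
      ((-z / 2 + (1 / 2 + μ)) * R₁ z + z * ((1 / 2 + μ - κ) * R₁' z)) * R₂ (-z)
  have hHc : Continuous H := by
    have h1 : Continuous R₁ := hR _ _
    have h2 : Continuous R₂ := hR _ _
    have h3 : Continuous R₁' := hR _ _
    have h4 : Continuous R₂' := hR _ _
    fun_prop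
  have hE : ∀ w : ℂ, exp (-exp w / 2 + (1 / 2 + μ) * w) *
      exp (- -exp w / 2 + (1 / 2 + -μ) * (w + Real.pi * I)) =
      exp ((1 / 2 - μ) * (Real.pi * I)) * exp w := fun w => by
    rw [← Complex.exp_add, ← Complex.exp_add]
    ring_nf
  have hWH : ∀ w, whittakerMRegWronskian κ μ (-μ) w =
      exp ((1 / 2 - μ) * (Real.pi * I)) * exp w * H (exp w) := fun w => by
    rw [← hE]
    simp only [whittakerMRegWronskian, whittakerMReg, whittakerMRegDeriv, exp_add_pi_mul_I, H,
      R₁, R₂, R₁', R₂']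
    ring
  have hH : ∀ z ∈ ({0}ᶜ : Set ℂ), H z = C / exp ((1 / 2 - μ) * (Real.pi * I)) := fun z hz => by
    have h1 := hC (log z)
    rw [hWH, Complex.exp_log hz] at h1
    rw [eq_div_iff (Complex.exp_ne_zero _)]
    refine mul_right_cancel₀ hz ?_
    rw [← h1]
    ring
  have hH0 : H 0 = C / exp ((1 / 2 - μ) * (Real.pi * I)) :=
    congrFun (hHc.ext_on (dense_compl_singleton 0) continuous_const hH) 0
  have hC' : C = H 0 * exp ((1 / 2 - μ) * (Real.pi * I)) := by
    rw [hH0, div_mul_cancel₀ _ (Complex.exp_ne_zero _)]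
  -- Here `H 0 = -2μ / (Γ(1+2μ) Γ(1-2μ))`, and the reflection formula applies.
  have hval : H 0 = -(sin (2 * Real.pi * μ) / Real.pi) := by
    have h1 := inv_Gamma_mul_inv_Gamma_one_sub (2 * μ)
    have h2 := Complex.one_div_Gamma_eq_self_mul_one_div_Gamma_add_one (2 * μ)
    rw [h2, add_comm (2 * μ), show (Real.pi : ℂ) * (2 * μ) = 2 * Real.pi * μ by ring] at h1
    simp only [H, R₁, R₂, neg_zero, kummerReg_zero, mul_neg, ← sub_eq_add_neg]
    linear_combination -h1
  rw [hC w, hC', hval]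

theorem inv_Gamma_half_add_mul_inv_Gamma_half_sub (x : ℂ) :
    (Gamma (1 / 2 + x))⁻¹ * (Gamma (1 / 2 - x))⁻¹ = cos (Real.pi * x) / Real.pi := by
  have h := inv_Gamma_mul_inv_Gamma_one_sub (1 / 2 + x)
  rw [show (1 : ℂ) - (1 / 2 + x) = 1 / 2 - x by ring,
    show (Real.pi : ℂ) * (1 / 2 + x) = Real.pi * x + Real.pi / 2 by ring,
    Complex.sin_add_pi_div_two] at h
  exact h

theorem cos_sub_mul_exp_sub_cos_add_mul_exp (a b : ℂ) :
    cos (a + b) * exp (-(a * I)) - cos (a - b) * exp (a * I) =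
      -(I * sin (2 * a) * exp (-(b * I))) := by
  have hA := Complex.exp_ne_zero (a * I)
  have hB := Complex.exp_ne_zero (b * I)
  have h2 : exp (2 * a * I) = exp (a * I) ^ 2 := by
    rw [← Complex.exp_nat_mul]; push_cast; ring_nf
  simp only [Complex.cos, Complex.sin, neg_mul, add_mul, sub_mul, neg_add, neg_sub, Complex.exp_add,
    Complex.exp_sub, Complex.exp_neg, h2]
  field_simp
  rw [Complex.I_sq]
  ring

theorem whittakerNum_wronskian (κ : ℂ) {μ : ℂ} (hμ : sin (2 * Real.pi * μ) ≠ 0) (w : ℂ) :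
    whittakerNum κ μ w * whittakerNumDeriv (-κ) μ (w + Real.pi * I) -
      whittakerNumDeriv κ μ w * whittakerNum (-κ) μ (w + Real.pi * I) =
      (sin (2 * Real.pi * μ) / Real.pi) ^ 2 * exp (-(Real.pi * κ * I)) * exp w := by
  have hμ' : sin (2 * Real.pi * -μ) ≠ 0 := by rwa [mul_neg, sin_neg, neg_ne_zero]
  have h1 := whittakerMRegWronskian_self κ hμ w
  have h2 := whittakerMRegWronskian_self κ hμ' w
  have h3 := whittakerMRegWronskian_neg κ μ w
  have h4 := whittakerMRegWronskian_neg κ (-μ) w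
  rw [neg_neg, mul_neg, sin_neg, sub_neg_eq_add] at h4
  have g1 := inv_Gamma_half_add_mul_inv_Gamma_half_sub (μ + κ)
  have g2 := inv_Gamma_half_add_mul_inv_Gamma_half_sub (μ - κ)
  have ht := cos_sub_mul_exp_sub_cos_add_mul_exp (Real.pi * μ) (Real.pi * κ)
  have e1 : exp ((1 / 2 - μ) * (Real.pi * I)) = I * exp (-(Real.pi * μ * I)) := by
    rw [← congrArg (· * exp (-(Real.pi * μ * I))) Complex.exp_pi_div_two_mul_I, ← Complex.exp_add]
    ring_nf
  have e2 : exp ((1 / 2 + μ) * (Real.pi * I)) = I * exp (Real.pi * μ * I) := by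
    rw [← congrArg (· * exp (Real.pi * μ * I)) Complex.exp_pi_div_two_mul_I, ← Complex.exp_add]
    ring_nf
  rw [e1] at h3
  rw [e2] at h4
  simp only [whittakerMRegWronskian] at h1 h2 h3 h4
  rw [show (1 : ℂ) / 2 + (μ + κ) = 1 / 2 + μ - -κ by ring,
    show (1 : ℂ) / 2 - (μ + κ) = 1 / 2 - μ - κ by ring, mul_add] at g1
  rw [show (1 : ℂ) / 2 + (μ - κ) = 1 / 2 + μ - κ by ring,
    show (1 : ℂ) / 2 - (μ - κ) = 1 / 2 - μ - -κ by ring, mul_sub] at g2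
  rw [show (2 : ℂ) * (Real.pi * μ) = 2 * Real.pi * μ by ring] at ht
  simp only [whittakerNum, whittakerNumDeriv]
  set α := (Gamma (1 / 2 + μ - κ))⁻¹
  set β := (Gamma (1 / 2 - μ - κ))⁻¹
  set α' := (Gamma (1 / 2 + μ - -κ))⁻¹
  set β' := (Gamma (1 / 2 - μ - -κ))⁻¹
  set S := sin (2 * Real.pi * μ)
  set A := exp (Real.pi * μ * I)
  set A' := exp (-(Real.pi * μ * I))
  -- Bilinear expansion of the Wronskian: the `(μ, μ)` and `(-μ, -μ)` terms vanish. In the two cross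
  -- terms `g1` and `g2` turn the Gamma products into `cos (π(μ ± κ))/π`, and `ht` sums the result.
  linear_combination α * α' * h2 + β * β' * h1 - α * β' * h4 - β * α' * h3
    + S / Real.pi * I * exp w * (A' * g1 - A * g2) + S / Real.pi ^ 2 * I * exp w * ht
    - S ^ 2 / Real.pi ^ 2 * exp (-(Real.pi * κ * I)) * exp w * Complex.I_sq

theorem whittakerJet_zero (κ μ w : ℂ) : whittakerJet κ μ 0 w = whittakerW κ μ w := by
  simp [whittakerJet]

theorem differentiable_whittakerW_right (κ μ : ℂ) : Differentiable ℂ (whittakerW κ μ) := by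
  obtain ⟨D, hD, -⟩ := exists_hasDerivAt_whittakerJet κ μ
  have h : whittakerJet κ μ 0 = whittakerW κ μ := funext (whittakerJet_zero κ μ)
  rw [← h]
  exact fun w => (hD 0 w).differentiableAt

theorem deriv_whittakerW_of_sin_ne_zero {κ μ : ℂ} (h : sin (2 * Real.pi * μ) ≠ 0) (w : ℂ) :
    deriv (whittakerW κ μ) w = Real.pi / sin (2 * Real.pi * μ) * whittakerNumDeriv κ μ w := by
  rw [funext (whittakerW_of_sin_ne_zero h)]
  exact ((hasDerivAt_whittakerNum κ μ w).const_mul _).deriv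

/-- For `ν` inside a circle around `μ`, Cauchy's formula can be differentiated in `w` under the
integral. The result is the Cauchy integral of a continuous function, hence analytic in `ν`. -/
theorem continuous_deriv_whittakerW (κ w : ℂ) :
    Continuous fun μ => deriv (whittakerW κ μ) w := by
  rw [continuous_iff_continuousAt]
  intro μ
  obtain ⟨r, hr, hball⟩ := exists_sphere_sin_ne_zero μ
  have hsph : ∀ ν ∈ Metric.sphere μ r, sin (2 * Real.pi * ν) ≠ 0 := fun ν hν =>
    hball ν (Metric.sphere_subset_closedBall hν) fun h => by
      rw [h, Metric.mem_sphere, dist_self] at hν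
      exact hr.ne hν
  have hW : ∀ ν ∈ Metric.ball μ r, ∀ x, whittakerW κ ν x =
      (2 * Real.pi * I)⁻¹ * whittakerCircle κ μ r (fun z => (z - ν)⁻¹) x := fun ν hν x => by
    rw [whittakerCircle_eq hr.le hsph]
    have h1 := ((differentiable_whittakerW κ x).differentiableOn
      (s := Metric.closedBall μ r)).circleIntegral_sub_inv_smul hν
    simp only [smul_eq_mul] at h1
    rw [h1, inv_mul_cancel_left₀ Complex.two_pi_I_ne_zero]
  have hD : ∀ ν ∈ Metric.ball μ r, deriv (whittakerW κ ν) w =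
      (2 * Real.pi * I)⁻¹ * whittakerCircleDeriv κ μ r (fun z => (z - ν)⁻¹) w := fun ν hν => by
    rw [funext (hW ν hν)]
    refine ((hasDerivAt_whittakerCircle hr.le hsph ?_ w).const_mul _).deriv
    refine ContinuousOn.inv₀ (by fun_prop) fun z hz h => ?_
    rw [sub_eq_zero.1 h] at hz
    exact (Metric.mem_ball.1 hν).ne (Metric.mem_sphere.1 hz)
  have hint : CircleIntegrable (fun z =>
      Real.pi / sin (2 * Real.pi * z) * whittakerNumDeriv κ z w) μ r := by
    refine ((continuousOn_pi_div_sin hsph).mul (Continuous.continuousOn ?_)).circleIntegrable hr.le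
    exact (continuous_whittakerNumDeriv κ).comp (f := fun ν : ℂ => (ν, w)) (by fun_prop)
  lift r to NNReal using hr.le
  have hps := (hasFPowerSeriesOn_cauchy_integral hint (by exact_mod_cast hr)).analyticAt
  refine hps.continuousAt.congr ?_
  filter_upwards [Metric.ball_mem_nhds μ hr] with ν hν
  rw [hD ν hν, smul_eq_mul, whittakerCircleDeriv]
  simp only [smul_eq_mul, mul_assoc]

/-- The Wronskian of `W_{κ,μ}(z)` and `W_{-κ,μ}(z e^{πi})` at `z = exp w`, in the variable `w`. -/
theorem whittakerW_wronskian (κ μ w : ℂ) :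
    whittakerW κ μ w * deriv (whittakerW (-κ) μ) (w + Real.pi * I) -
      deriv (whittakerW κ μ) w * whittakerW (-κ) μ (w + Real.pi * I) =
      exp (-(Real.pi * κ * I)) * exp w := by
  have hc : Continuous fun ν => whittakerW κ ν w * deriv (whittakerW (-κ) ν) (w + Real.pi * I) -
      deriv (whittakerW κ ν) w * whittakerW (-κ) ν (w + Real.pi * I) :=
    ((differentiable_whittakerW κ w).continuous.mul (continuous_deriv_whittakerW _ _)).sub
      ((continuous_deriv_whittakerW _ _).mul (differentiable_whittakerW _ _).continuous)
  -- Both sides are continuous in `μ`, so the generic case `2μ ∉ ℤ` suffices.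
  refine tendsto_nhds_unique_of_eventuallyEq (l := 𝓝[≠] μ)
    (hc.continuousAt.tendsto.mono_left nhdsWithin_le_nhds) tendsto_const_nhds ?_
  filter_upwards [eventually_sin_two_pi_mul_ne_zero μ] with ν hν
  have hpi : (Real.pi : ℂ) ≠ 0 := by exact_mod_cast Real.pi_ne_zero
  have h := whittakerNum_wronskian κ hν w
  rw [whittakerW_of_sin_ne_zero hν, whittakerW_of_sin_ne_zero hν,
    deriv_whittakerW_of_sin_ne_zero hν, deriv_whittakerW_of_sin_ne_zero hν]
  calc _ = (Real.pi / sin (2 * Real.pi * ν)) ^ 2 *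
        (whittakerNum κ ν w * whittakerNumDeriv (-κ) ν (w + Real.pi * I) -
        whittakerNumDeriv κ ν w * whittakerNum (-κ) ν (w + Real.pi * I)) := by ring
    _ = _ := by
      rw [h]
      generalize sin (2 * Real.pi * ν) = S at hν
      field_simp

/-! ### Kernels of powers of a second-order operator with two chains -/

/-- The operator `g ↦ g'' - g' - q g`. -/
noncomputable def abelOp (q g : ℝ → ℂ) : ℝ → ℂ :=
  fun x => deriv (deriv g) x - deriv g x - q x * g x

section Chain

variable {q : ℝ → ℂ}

theorem ContDiff.abelOp {m : ℕ} {g : ℝ → ℂ} (hq : ContDiff ℝ (⊤ : ℕ∞) q)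
    (hg : ContDiff ℝ (m + 2 : ℕ) g) : ContDiff ℝ m (abelOp q g) := by
  have h1 : ContDiff ℝ m (deriv (deriv g)) := ContDiff.iterate_deriv' m 2 hg
  have h2 : ContDiff ℝ m (deriv g) :=
    ContDiff.iterate_deriv' m 1 (hg.of_le (by exact_mod_cast (by omega : m + 1 ≤ m + 2)))
  have h3 : ContDiff ℝ m g := hg.of_le (by exact_mod_cast (by omega : m ≤ m + 2))
  have h4 : ContDiff ℝ m q := hq.of_le (by exact_mod_cast le_top)
  exact (h1.sub h2).sub (h4.mul h3)

theorem abelOp_add_const_mul {f g : ℝ → ℂ} (hf : ContDiff ℝ 2 f) (hg : ContDiff ℝ 2 g) (a : ℂ) :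
    abelOp q (fun x => f x + a * g x) = fun x => abelOp q f x + a * abelOp q g x := by
  have hd : ∀ {f : ℝ → ℂ}, ContDiff ℝ 2 f → Differentiable ℝ f ∧ Differentiable ℝ (deriv f) :=
    fun hf => ⟨hf.differentiable (by norm_num),
      (ContDiff.iterate_deriv' 1 1 hf).differentiable (by norm_num)⟩
  have h1 : deriv (fun x => f x + a * g x) = fun x => deriv f x + a * deriv g x := by
    ext x
    exact (((hd hf).1 x).hasDerivAt.fun_add (((hd hg).1 x).hasDerivAt.const_mul a)).deriv
  have h2 : deriv (fun x => deriv f x + a * deriv g x) =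
      fun x => deriv (deriv f) x + a * deriv (deriv g) x := by
    ext x
    exact (((hd hf).2 x).hasDerivAt.fun_add (((hd hg).2 x).hasDerivAt.const_mul a)).deriv
  ext x
  simp only [abelOp, h1, h2]
  ring

theorem abelOp_zero : abelOp q (fun _ => 0) = fun _ => 0 := by
  ext x
  simp [abelOp]

/-- The span of the first `m` members of each of the families `G b`. -/
def chainSpan (G : Bool → ℕ → ℝ → ℂ) (m : ℕ) : Submodule ℂ (ℝ → ℂ) :=
  Submodule.span ℂ {φ | ∃ b, ∃ j < m, φ = G b j}

theorem mem_chainSpan (G : Bool → ℕ → ℝ → ℂ) (b : Bool) {j m : ℕ} (h : j < m) :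
    G b j ∈ chainSpan G m :=
  Submodule.subset_span ⟨b, j, h, rfl⟩

theorem chainSpan_mono (G : Bool → ℕ → ℝ → ℂ) {m m' : ℕ} (h : m ≤ m') :
    chainSpan G m ≤ chainSpan G m' :=
  Submodule.span_mono fun _ ⟨b, j, hj, hφ⟩ => ⟨b, j, hj.trans_le h, hφ⟩

theorem exists_sum_of_mem_chainSpan {G : Bool → ℕ → ℝ → ℂ} {m : ℕ} {φ : ℝ → ℂ}
    (h : φ ∈ chainSpan G m) : ∃ a b : Fin m → ℂ, ∀ x,
      φ x = ∑ j : Fin m, (a j * G false j x + b j * G true j x) := by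
  induction h using Submodule.span_induction with
  | mem φ hφ =>
    obtain ⟨b, j, hj, rfl⟩ := hφ
    cases b
    · refine ⟨Pi.single ⟨j, hj⟩ 1, 0, fun x => ?_⟩
      rw [Finset.sum_eq_single ⟨j, hj⟩ (fun i _ hi => by simp [hi]) (by simp)]
      simp
    · refine ⟨0, Pi.single ⟨j, hj⟩ 1, fun x => ?_⟩
      rw [Finset.sum_eq_single ⟨j, hj⟩ (fun i _ hi => by simp [hi]) (by simp)]
      simp
  | zero => exact ⟨0, 0, fun x => by simp⟩
  | add φ ψ _ _ h1 h2 =>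
    obtain ⟨a, b, h1⟩ := h1
    obtain ⟨a', b', h2⟩ := h2
    refine ⟨a + a', b + b', fun x => ?_⟩
    rw [Pi.add_apply, h1, h2, ← Finset.sum_add_distrib]
    refine Finset.sum_congr rfl fun j _ => ?_
    simp only [Pi.add_apply]
    ring
  | smul t φ _ h1 =>
    obtain ⟨a, b, h1⟩ := h1
    refine ⟨t • a, t • b, fun x => ?_⟩
    rw [Pi.smul_apply, h1, smul_eq_mul, Finset.mul_sum]
    refine Finset.sum_congr rfl fun j _ => ?_
    simp only [Pi.smul_apply, smul_eq_mul]
    ring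

/-- The operator sends `G b (j+1)` to `c (j+1) * G b j` plus a multiple of `G b (j-1)`. If `χ` is a
preimage of that multiple, then `(G b (j+1) - χ) / c (j+1)` is a preimage of `G b j`. At `j = 0` the
extra term is absent, since `d 1 = 0`. -/
theorem exists_abelOp_eq_of_chain {G : Bool → ℕ → ℝ → ℂ} {c d : ℕ → ℂ}
    (hG : ∀ b j, ContDiff ℝ (⊤ : ℕ∞) (G b j))
    (hS : ∀ b j x, abelOp q (G b j) x = c j * G b (j - 1) x + d j * G b (j - 2) x)
    (hd1 : d 1 = 0) (hc : ∀ j, c (j + 1) ≠ 0) (b : Bool) (j : ℕ) :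
    ∃ ψ ∈ chainSpan G (j + 2), ContDiff ℝ (⊤ : ℕ∞) ψ ∧ abelOp q ψ = G b j := by
  have h2 : ∀ {f : ℝ → ℂ}, ContDiff ℝ (⊤ : ℕ∞) f → ContDiff ℝ 2 f :=
    fun hf => contDiff_infty.1 hf 2
  have key : ∀ j, ∀ χ ∈ chainSpan G (j + 2), ContDiff ℝ (⊤ : ℕ∞) χ →
      (∀ x, abelOp q χ x = d (j + 1) * G b (j - 1) x) →
      ∃ ψ ∈ chainSpan G (j + 2), ContDiff ℝ (⊤ : ℕ∞) ψ ∧ abelOp q ψ = G b j := by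
    intro j χ hχ hχs hSχ
    have h0 : ContDiff ℝ (⊤ : ℕ∞) (fun x => G b (j + 1) x + (-1) * χ x) :=
      (hG b (j + 1)).add (contDiff_const.mul hχs)
    -- The summand `0` gives the witness the shape required by `abelOp_add_const_mul`.
    refine ⟨fun x => 0 + (c (j + 1))⁻¹ * (G b (j + 1) x + (-1) * χ x), ?_,
      contDiff_const.add (contDiff_const.mul h0), ?_⟩
    · have h := (chainSpan G (j + 2)).smul_mem (c (j + 1))⁻¹ ((chainSpan G (j + 2)).add_mem
        (mem_chainSpan G b (Nat.lt_succ_self (j + 1))) ((chainSpan G (j + 2)).smul_mem (-1) hχ))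
      convert h using 1
      ext x
      simp
    · rw [abelOp_add_const_mul contDiff_const (h2 h0), abelOp_add_const_mul (h2 (hG b _)) (h2 hχs)]
      ext x
      have := hc j
      simp only [abelOp_zero, hS, hSχ, Nat.add_sub_cancel, show j + 1 - 2 = j - 1 by omega]
      field_simp
      ring
  induction j with
  | zero =>
    refine key 0 0 (Submodule.zero_mem _) contDiff_const fun x => ?_
    rw [hd1]
    simp [abelOp, Pi.zero_def]
  | succ j ih =>
    obtain ⟨ψ, hψ, hψs, hSψ⟩ := ih
    refine key (j + 1) (d (j + 1 + 1) • ψ)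
      (Submodule.smul_mem _ _ (chainSpan_mono G (by omega) hψ)) (contDiff_const.smul hψs)
      fun x => ?_
    have h := congrFun (abelOp_add_const_mul (q := q) (f := fun _ => 0) contDiff_const (h2 hψs)
      (d (j + 1 + 1))) x
    simp only [hSψ, abelOp_zero, zero_add] at h
    exact h

theorem mem_chainSpan_of_iterate_abelOp_eq_zero {G : Bool → ℕ → ℝ → ℂ} {c d : ℕ → ℂ}
    (hq : ContDiff ℝ (⊤ : ℕ∞) q) (hG : ∀ b j, ContDiff ℝ (⊤ : ℕ∞) (G b j))
    (hS : ∀ b j x, abelOp q (G b j) x = c j * G b (j - 1) x + d j * G b (j - 2) x)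
    (hc0 : c 0 = 0) (hd0 : d 0 = 0) (hd1 : d 1 = 0) (hc : ∀ j, c (j + 1) ≠ 0)
    (hW : ∀ x, G false 0 x * deriv (G true 0) x - deriv (G false 0) x * G true 0 x ≠ 0)
    (m : ℕ) {g : ℝ → ℂ} (hg : ContDiff ℝ (2 * m : ℕ) g) (h0 : (abelOp q)^[m] g = 0) :
    g ∈ chainSpan G m := by
  have h2 : ∀ {f : ℝ → ℂ}, ContDiff ℝ (⊤ : ℕ∞) f → ContDiff ℝ 2 f :=
    fun hf => contDiff_infty.1 hf 2
  have hder : ∀ {f : ℝ → ℂ}, ContDiff ℝ 2 f → (∀ x, abelOp q f x = 0) →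
      (∀ x, HasDerivAt f (deriv f x) x) ∧
        ∀ x, HasDerivAt (deriv f) (deriv f x + q x * f x) x := fun {f} hf hSf => by
    refine ⟨fun x => (hf.differentiable (by norm_num) x).hasDerivAt, fun x => ?_⟩
    have h1 : Differentiable ℝ (deriv f) :=
      (ContDiff.iterate_deriv' 1 1 hf).differentiable (by norm_num)
    refine (h1 x).hasDerivAt.congr_deriv ?_
    have := hSf x
    simp only [abelOp] at this
    linear_combination this
  have hker : ∀ f : ℝ → ℂ, ContDiff ℝ 2 f → (∀ x, abelOp q f x = 0) → f ∈ chainSpan G 1 := by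
    intro f hf hSf
    have hS0 : ∀ b x, abelOp q (G b 0) x = 0 := fun b x => by rw [hS, hc0, hd0]; ring
    obtain ⟨f1, f2⟩ := hder hf hSf
    obtain ⟨a1, a2⟩ := hder (h2 (hG false 0)) (hS0 false)
    obtain ⟨b1, b2⟩ := hder (h2 (hG true 0)) (hS0 true)
    have hE : ∀ x : ℝ, HasDerivAt (fun x : ℝ => exp (x : ℂ)) (exp (x : ℂ)) x := fun x =>
      (Complex.hasDerivAt_exp (x : ℂ)).comp_ofReal
    have hE0 : ∀ x : ℝ, exp (x : ℂ) ≠ 0 := fun x => Complex.exp_ne_zero _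
    obtain ⟨A, hA⟩ := wronskian_eq_mul f1 f2 b1 b2 hE hE0
    obtain ⟨B, hB⟩ := wronskian_eq_mul a1 a2 f1 f2 hE hE0
    obtain ⟨C, hC⟩ := wronskian_eq_mul a1 a2 b1 b2 hE hE0
    have hC0 : C ≠ 0 := fun h => hW 0 (by rw [hC 0, h, zero_mul])
    have hmem := (chainSpan G 1).add_mem
      ((chainSpan G 1).smul_mem (A / C) (mem_chainSpan G false one_pos))
      ((chainSpan G 1).smul_mem (B / C) (mem_chainSpan G true one_pos))
    convert hmem using 1
    ext x
    simp only [Pi.add_apply, Pi.smul_apply, smul_eq_mul]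
    have hx := hE0 x
    -- Cramer's rule: all three Wronskians are constant multiples of `exp x`, so the coefficients `A
    -- / C` and `B / C` are constants.
    have h3 : f x * (C * exp x) = G false 0 x * (A * exp x) + G true 0 x * (B * exp x) := by
      rw [← hA x, ← hB x, ← hC x]
      ring
    refine mul_right_cancel₀ (mul_ne_zero hC0 hx) ?_
    rw [h3]
    field_simp
  have hsurj : ∀ m, ∀ φ ∈ chainSpan G m,
      ∃ ψ ∈ chainSpan G (m + 1), ContDiff ℝ (⊤ : ℕ∞) ψ ∧ abelOp q ψ = φ := by
    intro m φ hφ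
    have hz : ∃ ψ ∈ chainSpan G (m + 1), ContDiff ℝ (⊤ : ℕ∞) ψ ∧ abelOp q ψ = 0 :=
      ⟨0, Submodule.zero_mem _, contDiff_const, by ext x; simp [abelOp, Pi.zero_def]⟩
    have hlin : ∀ φ₁ φ₂ : ℝ → ℂ, ∀ t : ℂ,
        (∃ ψ ∈ chainSpan G (m + 1), ContDiff ℝ (⊤ : ℕ∞) ψ ∧ abelOp q ψ = φ₁) →
        (∃ ψ ∈ chainSpan G (m + 1), ContDiff ℝ (⊤ : ℕ∞) ψ ∧ abelOp q ψ = φ₂) →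
        ∃ ψ ∈ chainSpan G (m + 1), ContDiff ℝ (⊤ : ℕ∞) ψ ∧ abelOp q ψ = φ₁ + t • φ₂ := by
      rintro _ _ t ⟨ψ₁, hψ₁, hs₁, rfl⟩ ⟨ψ₂, hψ₂, hs₂, rfl⟩
      exact ⟨fun x => ψ₁ x + t * ψ₂ x, Submodule.add_mem _ hψ₁ (Submodule.smul_mem _ t hψ₂),
        hs₁.add (contDiff_const.mul hs₂), abelOp_add_const_mul (h2 hs₁) (h2 hs₂) t⟩
    induction hφ using Submodule.span_induction with
    | mem φ hφ =>
      obtain ⟨b, j, hj, rfl⟩ := hφ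
      obtain ⟨ψ, hψ, h⟩ := exists_abelOp_eq_of_chain hG hS hd1 hc b j
      exact ⟨ψ, chainSpan_mono G (by omega) hψ, h⟩
    | zero => exact hz
    | add φ₁ φ₂ _ _ h₁ h₂ => simpa using hlin φ₁ φ₂ 1 h₁ h₂
    | smul t φ _ h => simpa using hlin 0 φ t hz h
  induction m generalizing g with
  | zero =>
    rw [show g = 0 from h0]
    exact Submodule.zero_mem _
  | succ m ih =>
    have hg2 : ContDiff ℝ 2 g := hg.of_le (by exact_mod_cast (by omega : 2 ≤ 2 * (m + 1)))
    -- By induction `abelOp q g` lies in the `m`-th span. Lifting it to `ψ` in the next span leaves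
    -- `g - ψ` in the kernel, where `hker` applies.
    obtain ⟨ψ, hψ, hψs, hSψ⟩ := hsurj m _ (ih (ContDiff.abelOp (m := 2 * m) hq hg)
      (by rw [← Function.iterate_succ_apply, h0]))
    have h3 := hker (fun x => g x + (-1) * ψ x) (hg2.add (contDiff_const.mul (h2 hψs))) fun x => by
      rw [abelOp_add_const_mul hg2 (h2 hψs), hSψ]
      ring
    have h4 := Submodule.add_mem _ (chainSpan_mono G (by omega : 1 ≤ m + 1) h3) hψ
    convert h4 using 1
    ext x
    simp

end Chain

/-! ### The chains of Whittaker functions -/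

section WhittakerChain

variable (κ μ : ℂ)

/-- The `μ`-derivatives of the two Whittaker solutions `W_{κ,μ}(e^x)` and `W_{-κ,μ}(e^{x+πi})`. -/
noncomputable def whittakerSol (b : Bool) (j : ℕ) (x : ℝ) : ℂ :=
  if b then whittakerJet (-κ) μ j (x + Real.pi * I) else whittakerJet κ μ j x

theorem contDiff_whittakerPotential :
    ContDiff ℝ (⊤ : ℕ∞) fun x : ℝ => whittakerPotential κ μ x := by
  have h : Differentiable ℂ (whittakerPotential κ μ) := by
    unfold whittakerPotential
    fun_prop
  exact ((h.contDiff (n := (⊤ : ℕ∞))).restrict_scalars ℝ).comp Complex.ofRealCLM.contDiff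

theorem exists_hasDerivAt_whittakerSol : ∃ D : Bool → ℕ → ℝ → ℂ,
    (∀ b j x, HasDerivAt (whittakerSol κ μ b j) (D b j x) x) ∧
    ∀ b j x, HasDerivAt (D b j) (D b j x + whittakerPotential κ μ x * whittakerSol κ μ b j x +
      2 * j * μ * whittakerSol κ μ b (j - 1) x + j * (j - 1) * whittakerSol κ μ b (j - 2) x) x := by
  obtain ⟨D₁, h1, h2⟩ := exists_hasDerivAt_whittakerJet κ μ
  obtain ⟨D₂, h3, h4⟩ := exists_hasDerivAt_whittakerJet (-κ) μ
  refine ⟨fun b j x => if b then D₂ j (x + Real.pi * I) else D₁ j x, fun b j x => ?_,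
    fun b j x => ?_⟩
  · cases b
    · exact (h1 j x).comp_ofReal
    · exact ((h3 j (x + Real.pi * I)).comp_add_const _ _).comp_ofReal
  · cases b
    · exact (h2 j x).comp_ofReal
    · have h := ((h4 j (x + Real.pi * I)).comp_add_const _ _).comp_ofReal
      rw [whittakerPotential_neg] at h
      exact h

theorem contDiff_whittakerSol (b : Bool) (j : ℕ) :
    ContDiff ℝ (⊤ : ℕ∞) (whittakerSol κ μ b j) := by
  have key : ∀ (κ : ℂ) (c : ℂ),
      ContDiff ℝ (⊤ : ℕ∞) fun x : ℝ => whittakerJet κ μ j (x + c) := fun κ c => by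
    obtain ⟨D, hD, -⟩ := exists_hasDerivAt_whittakerJet κ μ
    have h : Differentiable ℂ (whittakerJet κ μ j) := fun w => (hD j w).differentiableAt
    exact ((h.contDiff (n := (⊤ : ℕ∞))).restrict_scalars ℝ).comp
      (Complex.ofRealCLM.contDiff.add contDiff_const)
  cases b
  · simpa [whittakerSol, Function.comp_def] using! key κ 0
  · exact key (-κ) (Real.pi * I)

theorem abelOp_whittakerSol (b : Bool) (j : ℕ) (x : ℝ) :
    abelOp (fun x : ℝ => whittakerPotential κ μ x) (whittakerSol κ μ b j) x =
      2 * j * μ * whittakerSol κ μ b (j - 1) x + j * (j - 1) * whittakerSol κ μ b (j - 2) x := by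
  obtain ⟨D, h1, h2⟩ := exists_hasDerivAt_whittakerSol κ μ
  have h3 : deriv (whittakerSol κ μ b j) = D b j := funext fun x => (h1 b j x).deriv
  rw [abelOp, h3, (h2 b j x).deriv]
  ring

theorem whittakerSol_wronskian (x : ℝ) :
    whittakerSol κ μ false 0 x * deriv (whittakerSol κ μ true 0) x -
      deriv (whittakerSol κ μ false 0) x * whittakerSol κ μ true 0 x ≠ 0 := by
  have h1 : whittakerSol κ μ false 0 = fun x : ℝ => whittakerW κ μ x :=
    funext fun x => whittakerJet_zero κ μ x
  have h2 : whittakerSol κ μ true 0 = fun x : ℝ => whittakerW (-κ) μ (x + Real.pi * I) :=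
    funext fun x => whittakerJet_zero (-κ) μ _
  have d1 := (differentiable_whittakerW_right κ μ x).hasDerivAt.comp_ofReal
  have d2 := ((differentiable_whittakerW_right (-κ) μ (x + Real.pi * I)).hasDerivAt.comp_add_const
    _ _).comp_ofReal
  rw [h1, h2, d1.deriv, d2.deriv, whittakerW_wronskian]
  exact mul_ne_zero (Complex.exp_ne_zero _) (Complex.exp_ne_zero _)

end WhittakerChain

/-! ### Separation of variables for the Laplacian -/

/-- The function `a(y) e^{2πinx}` on the upper half-plane. -/
noncomputable def fourierMode (n : ℤ) (a : ℝ → ℂ) : ℍ → ℂ :=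
  fun z => a z.im * exp (2 * Real.pi * I * n * z.re)

theorem fourierMode_ofComplex (n : ℤ) (a : ℝ → ℂ) {w : ℂ} (hw : 0 < w.im) :
    fourierMode n a (UpperHalfPlane.ofComplex w) =
      a w.im * exp (2 * Real.pi * I * n * w.re) := by
  rw [UpperHalfPlane.ofComplex_apply_of_im_pos hw]
  rfl

theorem partialX_fourierMode (n : ℤ) (a : ℝ → ℂ) :
    partialX (fourierMode n a) = fourierMode n fun y => 2 * Real.pi * I * n * a y := by
  ext z
  have hz : ∀ t : ℝ, ((z : ℂ) + t • (1 : ℂ)).im = z.im := fun t => by simp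
  have hz' : ∀ t : ℝ, ((z : ℂ) + t • (1 : ℂ)).re = z.re + t := fun t => by simp
  have h1 : (fun t : ℝ => (fourierMode n a ∘ UpperHalfPlane.ofComplex) ((z : ℂ) + t • (1 : ℂ))) =
      fun t : ℝ => a z.im * exp (2 * Real.pi * I * n * (z.re + t : ℂ)) := by
    ext t
    rw [Function.comp_apply, fourierMode_ofComplex _ _ (by rw [hz]; exact z.im_pos), hz, hz']
    push_cast
    rfl
  have h2 : HasDerivAt (fun t : ℝ => a z.im * exp (2 * Real.pi * I * n * (z.re + t : ℂ)))
      (a z.im * (exp (2 * Real.pi * I * n * (z.re + (0 : ℝ) : ℂ)) *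
        (2 * Real.pi * I * n * 1))) 0 :=
    ((((Complex.ofRealCLM.hasDerivAt (x := (0 : ℝ))).const_add (z.re : ℂ)).const_mul
      (2 * Real.pi * I * n)).cexp).const_mul _
  rw [partialX, lineDeriv, h1, h2.deriv, fourierMode, Complex.ofReal_zero, add_zero]
  ring

/-- No differentiability of `a` is needed: the exponential is a nonzero constant in `y`, so where
`a` is not differentiable both derivatives take the default value `0`. This lets the operator
identity be iterated for arbitrary `a`. -/
theorem partialY_fourierMode (n : ℤ) (a : ℝ → ℂ) :
    partialY (fourierMode n a) = fourierMode n (deriv a) := by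
  ext z
  have hz : ∀ t : ℝ, ((z : ℂ) + t • I).im = z.im + t := fun t => by simp
  have hz' : ∀ t : ℝ, ((z : ℂ) + t • I).re = z.re := fun t => by simp
  -- Vertical lines leave the half-plane, so the formula is only used for `t` near `0`.
  have h1 : (fun t : ℝ => (fourierMode n a ∘ UpperHalfPlane.ofComplex) ((z : ℂ) + t • I)) =ᶠ[𝓝 0]
      fun t : ℝ => a (z.im + t) * exp (2 * Real.pi * I * n * z.re) := by
    filter_upwards [lt_mem_nhds (neg_lt_zero.2 z.im_pos)] with t ht
    rw [Function.comp_apply, fourierMode_ofComplex _ _ (by rw [hz]; linarith), hz, hz']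
  rw [partialY, lineDeriv, h1.deriv_eq, deriv_mul_const_field, deriv_comp_const_add, add_zero,
    fourierMode]

/-- The action of `Δ_k - lam` on the coefficient `a` of `a(y) e^{2πinx}`. -/
noncomputable def radialOp (k n : ℤ) (lam : ℂ) (a : ℝ → ℂ) : ℝ → ℂ := fun y =>
  y ^ 2 * deriv (deriv a) y + k * y * deriv a y +
    (-(4 * Real.pi ^ 2 * n ^ 2 * y ^ 2) + 2 * Real.pi * k * n * y - lam) * a y

theorem shiftedLaplacian_fourierMode (k n : ℤ) (lam : ℂ) (a : ℝ → ℂ) :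
    shiftedLaplacian k lam (fourierMode n a) = fourierMode n (radialOp k n lam a) := by
  ext z
  rw [shiftedLaplacian, hypLaplacian, partialX_fourierMode, partialX_fourierMode,
    partialY_fourierMode, partialY_fourierMode]
  simp only [fourierMode, radialOp]
  linear_combination (4 * Real.pi ^ 2 * n ^ 2 * z.im ^ 2 * a z.im -
    2 * Real.pi * n * k * z.im * a z.im - k * z.im * deriv a z.im) *
    exp (2 * Real.pi * I * n * z.re) * Complex.I_sq

theorem iterate_shiftedLaplacian_fourierMode (k n : ℤ) (lam : ℂ) (m : ℕ) (a : ℝ → ℂ) :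
    (shiftedLaplacian k lam)^[m] (fourierMode n a) = fourierMode n ((radialOp k n lam)^[m] a) := by
  induction m generalizing a with
  | zero => rfl
  | succ m ih =>
    rw [Function.iterate_succ_apply, Function.iterate_succ_apply, shiftedLaplacian_fourierMode, ih]

theorem contDiffOn_radialOp {k n : ℤ} {lam : ℂ} {m : ℕ} {a : ℝ → ℂ}
    (ha : ContDiffOn ℝ (m + 2 : ℕ) a (Set.Ioi 0)) :
    ContDiffOn ℝ m (radialOp k n lam a) (Set.Ioi 0) := by
  have h1 : ContDiffOn ℝ (m + 1 : ℕ) (deriv a) (Set.Ioi 0) :=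
    ha.deriv_of_isOpen isOpen_Ioi (by exact_mod_cast le_rfl)
  have h2 : ContDiffOn ℝ m (deriv (deriv a)) (Set.Ioi 0) :=
    h1.deriv_of_isOpen isOpen_Ioi (by exact_mod_cast le_rfl)
  have h3 : ContDiffOn ℝ m (deriv a) (Set.Ioi 0) := h1.of_le (by exact_mod_cast Nat.le_succ m)
  have h4 : ContDiffOn ℝ m a (Set.Ioi 0) :=
    ha.of_le (by exact_mod_cast (by omega : m ≤ m + 2))
  have h5 : ContDiffOn ℝ m (fun y : ℝ => (y : ℂ)) (Set.Ioi 0) :=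
    Complex.ofRealCLM.contDiff.contDiffOn
  unfold radialOp
  fun_prop

/-! ### Reduction to Whittaker's equation -/

/-- The substitution `y = e^x / N` followed by multiplication with `y^{k/2}`. -/
noncomputable def logSubst (k : ℤ) (N : ℝ) (a : ℝ → ℂ) : ℝ → ℂ := fun x =>
  exp (k / 2 * (x - Real.log N)) * a (Real.exp x / N)

theorem hasDerivAt_logSubst {k : ℤ} {N : ℝ} {a : ℝ → ℂ} {x : ℝ}
    (ha : DifferentiableAt ℝ a (Real.exp x / N)) :
    HasDerivAt (logSubst k N a)
      (logSubst k N (fun y => k / 2 * a y + y * deriv a y) x) x := by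
  have h1 : HasDerivAt (fun x : ℝ => exp (k / 2 * (x - Real.log N)))
      (exp (k / 2 * (x - Real.log N)) * (k / 2 * 1)) x :=
    (((Complex.ofRealCLM.hasDerivAt (x := x)).sub_const (Real.log N : ℂ)).const_mul
      (k / 2 : ℂ)).cexp
  have h2 : HasDerivAt (fun x : ℝ => a (Real.exp x / N))
      ((Real.exp x / N) • deriv a (Real.exp x / N)) x :=
    ha.hasDerivAt.scomp x ((Real.hasDerivAt_exp x).div_const N)
  refine (h1.fun_mul h2).congr_deriv ?_
  simp only [logSubst, Complex.real_smul]
  ring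

theorem ContDiffOn.logSubst {k : ℤ} {N : ℝ} (hN : 0 < N) {a : ℝ → ℂ} {m : ℕ}
    (ha : ContDiffOn ℝ m a (Set.Ioi 0)) : ContDiff ℝ m (logSubst k N a) := by
  have h1 : ContDiff ℝ m fun x : ℝ => a (Real.exp x / N) := by
    rw [← contDiffOn_univ]
    exact ha.comp (Real.contDiff_exp.div_const N).contDiffOn
      fun x _ => div_pos (Real.exp_pos x) hN
  have h2 : ContDiff ℝ m (fun x : ℝ => Complex.exp (k / 2 * ((x : ℂ) - Real.log N))) := by
    have h3 : ContDiff ℝ m (fun x : ℝ => (x : ℂ)) := Complex.ofRealCLM.contDiff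
    exact (contDiff_const.mul (h3.sub contDiff_const)).cexp
  exact h2.mul h1

/-- With `θ = y d/dy`, the factor `y^{k/2}` replaces `θ² - θ` by `(θ + k/2)² - (θ + k/2)`, which is
`y² ∂² + k y ∂` plus `(k/2)(k/2 - 1)`. That constant cancels because `μ² - 1/4 = λ + (k/2)(k/2 -
1)`. -/
theorem abelOp_logSubst {k n : ℤ} (hn : n ≠ 0) {lam s₀ : ℂ}
    (hlam : lam = s₀ * (s₀ + (k : ℂ) - 1)) {a : ℝ → ℂ} (ha : ContDiffOn ℝ 2 a (Set.Ioi 0)) :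
    abelOp (fun x : ℝ => whittakerPotential ((n.sign : ℂ) * (k : ℂ) / 2)
        (s₀ + ((k : ℂ) - 1) / 2) x) (logSubst k (4 * Real.pi * |(n : ℝ)|) a) =
      logSubst k (4 * Real.pi * |(n : ℝ)|) (radialOp k n lam a) := by
  set N : ℝ := 4 * Real.pi * |(n : ℝ)| with hNdef
  have hN : 0 < N := by
    have : (n : ℝ) ≠ 0 := by exact_mod_cast hn
    positivity
  have hpos : ∀ x, Real.exp x / N ∈ Set.Ioi (0 : ℝ) := fun x => div_pos (Real.exp_pos x) hN
  have hd : ∀ y ∈ Set.Ioi (0 : ℝ), DifferentiableAt ℝ a y := fun y hy =>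
    (ha.differentiableOn (by norm_num)).differentiableAt (Ioi_mem_nhds hy)
  have hd' : ∀ y ∈ Set.Ioi (0 : ℝ), DifferentiableAt ℝ (deriv a) y := fun y hy =>
    ((ha.deriv_of_isOpen (m := 1) isOpen_Ioi (by norm_num)).differentiableOn
      (by norm_num)).differentiableAt (Ioi_mem_nhds hy)
  have h1 : deriv (logSubst k N a) = logSubst k N (fun y => k / 2 * a y + y * deriv a y) :=
    funext fun x => (hasDerivAt_logSubst (hd _ (hpos x))).deriv
  ext x
  have h2 : HasDerivAt (fun y : ℝ => k / 2 * a y + y * deriv a y)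
      (k / 2 * deriv a (Real.exp x / N) + (1 * deriv a (Real.exp x / N) +
        ((Real.exp x / N : ℝ) : ℂ) * deriv (deriv a) (Real.exp x / N))) (Real.exp x / N) :=
    ((hd _ (hpos x)).hasDerivAt.const_mul _).fun_add
      ((Complex.ofRealCLM.hasDerivAt).fun_mul (hd' _ (hpos x)).hasDerivAt)
  rw [abelOp, h1, (hasDerivAt_logSubst h2.differentiableAt).deriv]
  simp only [logSubst, h2.deriv, radialOp, whittakerPotential]
  have hsq : (N : ℂ) ^ 2 = 16 * Real.pi ^ 2 * n ^ 2 := by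
    rw [← Complex.ofReal_pow, hNdef, mul_pow, sq_abs]
    push_cast
    ring
  have hsgn : (n.sign : ℂ) * N = 4 * Real.pi * n := by
    have h : (n.sign : ℂ) * ((|n| : ℤ) : ℂ) = n := by exact_mod_cast Int.sign_mul_abs n
    have h' : (N : ℂ) = 4 * Real.pi * ((|n| : ℤ) : ℂ) := by
      rw [hNdef, ← Int.cast_abs]
      simp only [Complex.ofReal_mul, Complex.ofReal_intCast, Complex.ofReal_ofNat]
    rw [h']
    linear_combination 4 * Real.pi * h
  have hex : exp (x : ℂ) = N * ((Real.exp x / N : ℝ) : ℂ) := by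
    have : (N : ℂ) ≠ 0 := by exact_mod_cast hN.ne'
    push_cast
    field_simp
  rw [hex, hlam]
  generalize exp (k / 2 * ((x : ℂ) - Real.log N)) = E
  generalize Real.exp x / N = y
  linear_combination -(E * a y * y ^ 2 / 4) * hsq + (E * a y * y * k / 2) * hsgn

theorem iterate_abelOp_logSubst {k n : ℤ} (hn : n ≠ 0) {lam s₀ : ℂ}
    (hlam : lam = s₀ * (s₀ + (k : ℂ) - 1)) (m : ℕ) {a : ℝ → ℂ}
    (ha : ContDiffOn ℝ (2 * m : ℕ) a (Set.Ioi 0)) :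
    (abelOp (fun x : ℝ => whittakerPotential ((n.sign : ℂ) * (k : ℂ) / 2)
        (s₀ + ((k : ℂ) - 1) / 2) x))^[m] (logSubst k (4 * Real.pi * |(n : ℝ)|) a) =
      logSubst k (4 * Real.pi * |(n : ℝ)|) ((radialOp k n lam)^[m] a) := by
  induction m generalizing a with
  | zero => rfl
  | succ m ih =>
    rw [Function.iterate_succ_apply, Function.iterate_succ_apply, abelOp_logSubst hn hlam
      (ha.of_le (by exact_mod_cast (by omega : 2 ≤ 2 * (m + 1)))),
      ih (contDiffOn_radialOp (m := 2 * m) ha)]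

/-! ### Assembly of the expansion -/

theorem iteratedDeriv_whittakerW_shift (κ c s₀ w : ℂ) (j : ℕ) :
    iteratedDeriv j (fun s : ℂ => whittakerW κ (s + c) w) s₀ = whittakerJet κ (s₀ + c) j w :=
  congrFun (iteratedDeriv_comp_add_const j (fun ν => whittakerW κ ν w) c) s₀

/-- On the imaginary axis the exponential factor is `1`, so the coefficient is the restriction of
the mode to that axis. -/
theorem contDiffOn_of_fourierMode {n : ℤ} {m : ℕ} {h : ℝ → ℂ}
    (hf : ContDiffOn ℝ m (fourierMode n h ∘ UpperHalfPlane.ofComplex) {z : ℂ | 0 < z.im}) :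
    ContDiffOn ℝ m h (Set.Ioi 0) := by
  have hI : ContDiffOn ℝ m (fun y : ℝ => (y : ℂ) * I) (Set.Ioi 0) :=
    (Complex.ofRealCLM.contDiff.mul contDiff_const).contDiffOn
  refine (hf.comp hI fun y hy => by simpa using! hy).congr fun y hy => ?_
  rw [Function.comp_apply, Function.comp_apply, fourierMode_ofComplex _ _ (by simpa using! hy)]
  simp

theorem mainTheorem6 (k : ℤ) (hk : Even k) (n : ℤ) (hn : n ≠ 0) (m : ℕ) (lam s₀ : ℂ)
    (hlam : lam = s₀ * (s₀ + (k : ℂ) - 1)) (h : ℝ → ℂ)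
    (hf : IsShiftedPolyharmonic k lam m
      (fun z : ℍ => h z.im * Complex.exp (2 * Real.pi * Complex.I * n * z.re))) :
    ∃ aMinus aPlus : Fin m → ℂ, ∀ y : ℝ, 0 < y →
      h y = ∑ j : Fin m, (aMinus j * uMinus k n j s₀ y + aPlus j * uPlus k n j s₀ y) := by
  obtain ⟨hsmooth, hharm⟩ := hf
  have hh : ContDiffOn ℝ (2 * m : ℕ) h (Set.Ioi 0) := contDiffOn_of_fourierMode (n := n) hsmooth
  set κ : ℂ := (n.sign : ℂ) * (k : ℂ) / 2 with hκ
  set μ : ℂ := s₀ + ((k : ℂ) - 1) / 2 with hμ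
  set N : ℝ := 4 * Real.pi * |(n : ℝ)| with hNdef
  have hN : 0 < N := by
    have : (n : ℝ) ≠ 0 := by exact_mod_cast hn
    positivity
  have hrad : ∀ y : ℝ, 0 < y → (radialOp k n lam)^[m] h y = 0 := fun y hy => by
    have h1 := hharm ⟨y * I, by simpa using hy⟩
    change (shiftedLaplacian k lam)^[m] (fourierMode n h) _ = 0 at h1
    rw [iterate_shiftedLaplacian_fourierMode, fourierMode] at h1
    have h2 := (mul_eq_zero.1 h1).resolve_right (Complex.exp_ne_zero _)
    have h3 : UpperHalfPlane.im ⟨y * I, by simpa using hy⟩ = y := by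
      change ((y : ℂ) * I).im = y
      simp
    rwa [h3] at h2
  have hg0 : (abelOp fun x : ℝ => whittakerPotential κ μ x)^[m] (logSubst k N h) = 0 := by
    rw [iterate_abelOp_logSubst hn hlam m hh]
    ext x
    rw [logSubst, hrad _ (div_pos (Real.exp_pos x) hN), mul_zero, Pi.zero_apply]
  have hμ0 : s₀ = (1 - (k : ℂ)) / 2 ↔ μ = 0 := by
    constructor <;> intro h'
    · rw [hμ, h']; ring
    · linear_combination h'
  have hspan : logSubst k N h ∈
      chainSpan (fun b j => whittakerSol κ μ b (derivOrder k s₀ j)) m := by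
    by_cases hs : s₀ = (1 - (k : ℂ)) / 2
    -- At `μ = 0` the term with coefficient `2jμ` disappears and the even derivatives form a chain,
    -- in which the former second-order step becomes a step of one.
    · refine mem_chainSpan_of_iterate_abelOp_eq_zero (c := fun j => 2 * j * (2 * j - 1))
        (d := fun _ => 0) (contDiff_whittakerPotential κ μ)
        (fun b j => contDiff_whittakerSol κ μ b _) (fun b j x => ?_) (by simp) rfl rfl
        (fun j => ?_) (fun x => ?_) m (hh.logSubst hN) hg0
      · rw [abelOp_whittakerSol, hμ0.1 hs]
        simp only [derivOrder, if_pos hs, show 2 * j - 2 = 2 * (j - 1) by omega]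
        push_cast
        ring
      · have h1 : (2 : ℂ) * ((j + 1 : ℕ) : ℂ) * (2 * ((j + 1 : ℕ) : ℂ) - 1) =
            (((2 * (j + 1)) * (2 * j + 1) : ℕ) : ℂ) := by push_cast; ring
        simp only [h1]
        exact_mod_cast (by positivity : 2 * (j + 1) * (2 * j + 1) ≠ 0)
      · simpa [derivOrder] using whittakerSol_wronskian κ μ x
    · refine mem_chainSpan_of_iterate_abelOp_eq_zero (c := fun j => 2 * j * μ)
        (d := fun j => j * (j - 1)) (contDiff_whittakerPotential κ μ)
        (fun b j => contDiff_whittakerSol κ μ b _) (fun b j x => ?_) (by simp) (by simp) (by simp)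
        (fun j => ?_) (fun x => ?_) m (hh.logSubst hN) hg0
      · rw [abelOp_whittakerSol]
        simp only [derivOrder, if_neg hs]
      · refine mul_ne_zero (mul_ne_zero two_ne_zero (Nat.cast_ne_zero.2 j.succ_ne_zero)) ?_
        exact mt hμ0.2 hs
      · simpa [derivOrder] using whittakerSol_wronskian κ μ x
  obtain ⟨a, b, hab⟩ := exists_sum_of_mem_chainSpan hspan
  refine ⟨a, b, fun y hy => ?_⟩
  have hy' : (y : ℂ) ≠ 0 := by exact_mod_cast hy.ne'
  -- The point `x = log (N y)` is the one that the logarithmic substitution sends to `y`.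
  have h1 := hab (Real.log (N * y))
  have h2 : Real.exp (Real.log (N * y)) / N = y := by
    rw [Real.exp_log (mul_pos hN hy), mul_div_cancel_left₀ _ hN.ne']
  have h3 : exp (k / 2 * ((Real.log (N * y) : ℂ) - Real.log N)) = ((y : ℂ) ^ (-(k : ℂ) / 2))⁻¹ := by
    rw [Real.log_mul hN.ne' hy.ne', Complex.cpow_def_of_ne_zero hy', ← Complex.exp_neg,
      ← Complex.ofReal_log hy.le]
    push_cast
    ring_nf
  rw [logSubst, h2, h3, inv_mul_eq_iff_eq_mul₀ (by simp [Complex.cpow_eq_zero_iff, hy']),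
    Finset.mul_sum] at h1
  rw [h1]
  refine Finset.sum_congr rfl fun j _ => ?_
  simp only [uMinus, uPlus, whittakerWReal, whittakerMPlus, iteratedDeriv_whittakerW_shift,
    whittakerSol, ← hNdef, ← hκ, ← hμ, if_true, Bool.false_eq_true, if_false]
  ring
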